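/- All CNF formulas are finite sets of clauses, and a clause is a finite set of literals that does not contain both a variable and its negation. A \emph{resolution refutation} of a CNF formula $F$ is a sequence $(\mathbb{D}_0,\dots,\mathbb{D}_\tau)$ of sets of clauses with $\mathbb{D}_0=\emptyset$ and $\bot\in\mathbb{D}_\tau$ (where $\bot$ is the empty clause), in which each $\mathbb{D}_t$ arises from $\mathbb{D}_{t-1}$ by adding a clause of $F$, by adding a clause $B\lor C$ obtained by resolution from clauses $B\lor x$ and $C\lor\overline{x}$ in $\mathbb{D}_{t-1}$, by adding a weakening $B\lor C$ of a clause $B\in\mathbb{D}_{t-1}$, or by deleting clauses. Its \emph{width} is the maximal number of literals in a clause appearing in it, and its \emph{space} is $\max_t|\mathbb{D}_t|$. For a bipartite graph $\mathcal{G}=(U\,\dot\cup\,V,E)$ and a CNF formula $F$ over the variables $U$, the \emph{XORification} $F[\mathcal{G}]$ is the CNF formula over the variables $V$ obtained by substituting $\bigoplus_{v\in N(u)}v$ for every variable $u\in U$ and expanding every clause of $F$ to CNF in the canonical way: the positive literal $u$ becomes the set of all clauses over exactly the variables $N(u)$ with an even number of negated variables, the literal $\overline{u}$ becomes the set of those with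 an odd number of negated variables, a clause becomes the set of all disjunctions of one such clause for each of its literals, and disjunctions that contain a variable and its negation are removed. \textbf{Lemma (Hardness condensation lemma, strong version).} For all integers $k\ge 1$ and all $\varepsilon>0$ there are an integer $n_0\ge 1$ and a real $\delta>0$ such that the following holds. Let $\ell$ and $n$ be integers with $n\ge n_0$ and $k\le\ell\le n^{\frac12-\varepsilon}$, and let $F$ be an unsatisfiable CNF formula over $N=\lfloor n^{\delta\ell}\rfloor$ variables for which the minimal width of a resolution refutation is exactly $k$. Then there is a bipartite graph $\mathcal{G}=(U\,\dot\cup\,V,E)$ with $|U|=N$ and $|V|=n$ such that the $n$-variable CNF formula $F[\mathcal{G}]$ has the following two properties. \begin{itemize} \item $F[\mathcal{G}]$ has a resolution refutation of width at most $\ell$. \item Every resolution refutation $\pi$ of $F[\mathcal{G}]$ in width $w\le\ell\log_2 n$ has space at least $(s-w-3)\,2^{-w}$, where $s$ is the minimal space of a resolution refutation of $F$ of width at most $w$ (in particular, $F$ has a refutation of width at most $w$ whenever $F[\mathcal{G}]$ has one). \end{itemize} -/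

import Mathlib

namespace Resolution

/-- A literal over the variable set `V`: `(v, true)` is the positive literal `v`, and
`(v, false)` is the negative literal `¬v`. -/
abbrev Literal (V : Type*) := V × Bool

/-- A clause: a finite set of literals that does not contain a variable together with its
negation. -/
abbrev Clause (V : Type*) :=
  {C : Finset (Literal V) // ∀ v : V, (v, true) ∈ C → (v, false) ∉ C}

/-- A CNF formula over the variable set `V`: a finite set of clauses. -/
abbrev CNF (V : Type*) := Finset (Clause V)

/-- The empty clause. -/
def emptyClause (V : Type*) : Clause V := ⟨∅, by simp⟩

/-- The truth value assignment `α` satisfies the clause `C`. -/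
def Clause.SatisfiedBy {V : Type*} (C : Clause V) (α : V → Bool) : Prop :=
  ∃ a ∈ C.1, α a.1 = a.2

/-- The CNF formula `F` has no satisfying assignment. -/
def CNF.Unsatisfiable {V : Type*} (F : CNF V) : Prop :=
  ¬ ∃ α : V → Bool, ∀ C ∈ F, Clause.SatisfiedBy C α

section Refutations

variable {V : Type*} [DecidableEq V]

/-- `D` is obtained from `A = B ∨ x` and `A' = C ∨ ¬x` by the resolution rule, that is,
`D = B ∨ C`. -/
def IsResolvent (x : V) (A A' D : Clause V) : Prop :=
  (x, true) ∈ A.1 ∧ (x, false) ∈ A'.1 ∧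
    D.1 = A.1.erase (x, true) ∪ A'.1.erase (x, false)

/-- A configuration: the finite set of clauses that are in memory. -/
abbrev Configuration (V : Type*) := Finset (Clause V)

/-- One derivation step of a (configuration-style) resolution refutation of `F`. -/
inductive Step (F : CNF V) : Configuration V → Configuration V → Prop
  | download (M : Configuration V) (C : Clause V) (hC : C ∈ F) : Step F M (insert C M)
  | resolution (M : Configuration V) (x : V) (A A' D : Clause V) (hA : A ∈ M) (hA' : A' ∈ M)
      (hD : IsResolvent x A A' D) : Step F M (insert D M)
  | weakening (M : Configuration V) (B D : Clause V) (hB : B ∈ M) (hD : B.1 ⊆ D.1) :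
      Step F M (insert D M)
  | erasure (M M' : Configuration V) (h : M' ⊆ M) : Step F M (M \ M')

/-- A resolution refutation of `F`: a sequence of configurations `conf 0, …, conf len` (later
values of `conf` are irrelevant) that starts with the empty memory, proceeds by derivation steps,
and ends with a configuration containing the empty clause. -/
structure Refutation (F : CNF V) where
  len : ℕ
  conf : ℕ → Configuration V
  conf_zero : conf 0 = ∅
  step : ∀ t < len, Step F (conf t) (conf (t + 1))
  emptyClause_mem : emptyClause V ∈ conf len

/-- The width of a refutation: the largest number of literals in a clause that appears in it. -/
def Refutation.width {F : CNF V} (π : Refutation F) : ℕ :=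
  (Finset.range (π.len + 1)).sup fun t => (π.conf t).sup fun C => C.1.card

/-- The (clause) space of a refutation: the largest number of clauses in memory. -/
def Refutation.space {F : CNF V} (π : Refutation F) : ℕ :=
  (Finset.range (π.len + 1)).sup fun t => (π.conf t).card

/-- `k` is the minimal width of a refutation of `F`. -/
def IsRefutationWidth (F : CNF V) (k : ℕ) : Prop :=
  IsLeast {m : ℕ | ∃ π : Refutation F, π.width = m} k

/-- `s` is the minimal space of a refutation of `F` among those of width at most `w` (in
particular there is such a refutation). -/
def IsMinSpaceInWidth (F : CNF V) (w s : ℕ) : Prop :=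
  IsLeast {m : ℕ | ∃ π : Refutation F, π.width ≤ w ∧ π.space = m} s

end Refutations

section Xorification

variable {U V : Type*} [DecidableEq U] [Fintype V] [DecidableEq V]

/-- The right neighbours of the left vertex `u` in a graph on `U ⊕ V`. -/
noncomputable def nbhd (G : SimpleGraph (U ⊕ V)) (u : U) : Finset V :=
  open Classical in Finset.univ.filter fun v => G.Adj (Sum.inl u) (Sum.inr v)

/-- The variables that occur in a clause. -/
def Clause.vars (C : Clause V) : Finset V := C.1.image Prod.fst

/-- `D` is a clause of the canonical CNF of the literal `a` after substitution. For `a = u` this is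
the CNF of `⨁_{v ∈ N(u)} v`: all clauses over exactly the variables `N(u)` with an even number of
negative literals (the only assignment to `N(u)` that falsifies `D` is true exactly on the variables
that are negated in `D`, so `D` excludes one assignment of even parity). For `a = ¬u` it is the CNF
of the negation `¬ ⨁_{v ∈ N(u)} v`: all such clauses with an odd number of negative literals. -/
def IsXorLiteralClause (G : SimpleGraph (U ⊕ V)) (a : Literal U) (D : Clause V) : Prop :=
  Clause.vars D = nbhd G a.1 ∧
    (Even (D.1.filter fun b => b.2 = false).card ↔ a.2 = true)

/-- The XORified clause `C[G] = ⋁_{a ∈ C} a[G]`, expanded out to CNF: its clauses are the unions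
of one clause from the CNF of `a[G]` for every `a ∈ C`, where the unions that contain a variable
and its negation are left out (they are not clauses). -/
noncomputable def xorClause (G : SimpleGraph (U ⊕ V)) (C : Clause U) : CNF V :=
  open Classical in Finset.univ.filter fun D : Clause V =>
    ∃ f : Literal U → Clause V, (∀ a ∈ C.1, IsXorLiteralClause G a (f a)) ∧
      D.1 = C.1.biUnion fun a => (f a).1

/-- The XORification `F[G]` of `F` with respect to the bipartite graph `G`: the conjunction of the
XORified clauses. -/
noncomputable def xorify (G : SimpleGraph (U ⊕ V)) (F : CNF U) : CNF V :=
  F.biUnion fun C => xorClause G C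

end Xorification

end Resolution

/-!
Hardness condensation for resolution: XORification with respect to a random sparse bipartite graph
reduces the number of variables and preserves small-width refutations and lower bounds on the
space in small width.

Upper bound on the width. If every `u` is replaced by the parity of at most `d` variables, then a
refutation of `F` of width `k` is simulated by keeping all clauses of `C[G]` in memory instead of
`C`. Each new clause follows from clauses in memory over at most `d * (k + 1)` variables, and
`chain_insert_of_forall` turns such a semantic implication into a tree-like derivation. This is
`exists_refutation_xorify`.

Lower bound on the space. The graph is an expander in a linear-algebraic sense (`IsXorExpander`):
over the field with two elements, the sum of any `t ≤ r` of the neighbourhoods has at least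
`4 * t` elements. For a set `Y` of variables of the XORification, the `relevant` variables are
those `u` that occur in a set of at most `r` neighbourhoods whose sum lies in `Y`. These sets form
a linear code, a relevant variable lies in half of the code words, and a code word has at most
`|Y| / 4` elements; hence there are at most `|Y| / 2` relevant variables
(`two_mul_card_relevant_le`). By linear algebra the relevant variables carry all the constraints
that an assignment to `Y` imposes on few parities (`exists_xorEval_eq_of_relevant`). A clause `D`
of the XORification is represented by the set `unlift N r D` of the clauses over the variables
relevant for `D` that are false under the parities of an assignment that falsifies `D`; there are
at most `2 ^ w` of them if `D` has width at most `w`. Each derivation step of a refutation of the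
XORification turns into semantic implications over at most `w` variables between the representing
clauses: relevance is monotone in `Y`, and in the resolution step the `w + 1` variables of the
resolvent and of the variable resolved upon still have at most `w` relevant ones. The tree-like
derivations need `w + 3` additional clauses. This is `exists_refutation_of_xorify`.

Existence of expanders. If every vertex chooses `d ≥ 8` neighbours at random, a union bound shows
that with positive probability the union of the neighbourhoods of any `t ≤ r` vertices has at
least `3 * d * t / 4` elements, and then their symmetric difference has at least
`d * t / 2 ≥ 4 * t` elements (`exists_neighbours`, `exists_isXorExpander`,
`eventually_exists_isXorExpander`). If `ℓ` is bounded in terms of `k`, the degree `ℓ / (k + 1)`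
may be too small for this, but then `F` has at most `n` variables, and a matching does:
XORification is a renaming of variables (`exists_refutation_xorify_of_matching`,
`exists_refutation_of_xorify_of_matching`).
-/

namespace Resolution

/-! ### Clauses and falsifying assignments -/

section Clauses

variable {V : Type*}

/-- The clause `C` is false under the assignment `σ`. -/
def Clause.FalsifiedBy (C : Clause V) (σ : V → Bool) : Prop :=
  ∀ a ∈ C.1, a.2 = !σ a.1

theorem Clause.FalsifiedBy.mono {C D : Clause V} {σ : V → Bool} (hD : D.FalsifiedBy σ)
    (h : C.1 ⊆ D.1) : C.FalsifiedBy σ := fun a ha => hD a (h ha)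

variable [DecidableEq V]

/-- The only clause with variable set `W` that is false under `σ`. -/
def falsClause (σ : V → Bool) (W : Finset V) : Clause V :=
  ⟨W.image fun v => (v, !σ v), by
    intro v h h'
    simp only [Finset.mem_image, Prod.mk.injEq] at h h'
    obtain ⟨a, -, rfl, h⟩ := h
    obtain ⟨b, -, rfl, h'⟩ := h'
    simp_all⟩

theorem mem_falsClause {σ : V → Bool} {W : Finset V} {a : Literal V} :
    a ∈ (falsClause σ W).1 ↔ a.1 ∈ W ∧ a.2 = !σ a.1 := by
  obtain ⟨v, b⟩ := a
  simp only [falsClause, Finset.mem_image, Prod.mk.injEq]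
  constructor
  · rintro ⟨v, h, rfl, rfl⟩; exact ⟨h, rfl⟩
  · rintro ⟨h, rfl⟩; exact ⟨v, h, rfl, rfl⟩

theorem Clause.mem_vars {C : Clause V} {v : V} : v ∈ C.vars ↔ ∃ b, (v, b) ∈ C.1 := by
  simp [Clause.vars]

theorem Clause.fst_mem_vars {C : Clause V} {a : Literal V} (h : a ∈ C.1) : a.1 ∈ C.vars :=
  Finset.mem_image_of_mem _ h

theorem Clause.vars_mono {C D : Clause V} (h : C.1 ⊆ D.1) : C.vars ⊆ D.vars :=
  Finset.image_subset_image h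

theorem Clause.FalsifiedBy.congr {C : Clause V} {σ τ : V → Bool} (hC : C.FalsifiedBy σ)
    (h : ∀ v ∈ C.vars, τ v = σ v) : C.FalsifiedBy τ := fun a ha => by
  rw [h _ (Clause.fst_mem_vars ha)]; exact hC a ha

theorem Clause.exists_falsifiedBy (C : Clause V) : ∃ σ, C.FalsifiedBy σ := by
  refine ⟨fun v => decide ((v, false) ∈ C.1), ?_⟩
  rintro ⟨v, b⟩ h
  cases b with
  | false => simp [h]
  | true => simp [C.2 v h]

theorem Clause.card_vars (C : Clause V) : C.vars.card = C.1.card := by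
  refine Finset.card_image_of_injOn ?_
  obtain ⟨σ, hσ⟩ := C.exists_falsifiedBy
  rintro a ha b hb hab
  refine Prod.ext hab ?_
  rw [hσ a ha, hσ b hb, hab]

theorem falsClause_falsifiedBy (σ : V → Bool) (W : Finset V) :
    (falsClause σ W).FalsifiedBy σ := fun _ ha => (mem_falsClause.1 ha).2

theorem vars_falsClause (σ : V → Bool) (W : Finset V) : (falsClause σ W).vars = W := by
  ext v
  simp [Clause.mem_vars, mem_falsClause]

theorem card_falsClause (σ : V → Bool) (W : Finset V) : (falsClause σ W).1.card = W.card := by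
  rw [← Clause.card_vars, vars_falsClause]

theorem subset_falsClause_iff {C : Clause V} {σ : V → Bool} {W : Finset V} :
    C.1 ⊆ (falsClause σ W).1 ↔ C.vars ⊆ W ∧ C.FalsifiedBy σ := by
  constructor
  · intro h
    exact ⟨(Clause.vars_mono h).trans (vars_falsClause σ W).subset,
      (falsClause_falsifiedBy σ W).mono h⟩
  · rintro ⟨h, h'⟩ a ha
    exact mem_falsClause.2 ⟨h (Clause.fst_mem_vars ha), h' a ha⟩

theorem falsClause_congr {σ τ : V → Bool} {W : Finset V} (h : ∀ v ∈ W, σ v = τ v) :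
    falsClause σ W = falsClause τ W := by
  apply Subtype.ext
  ext a
  rw [mem_falsClause, mem_falsClause]
  refine and_congr_right fun ha => ?_
  rw [h _ ha]

theorem Clause.FalsifiedBy.eq_of_mem {σ τ : V → Bool} {W : Finset V}
    (h : (falsClause σ W).FalsifiedBy τ) : ∀ v ∈ W, τ v = σ v := fun v hv => by
  have := h (v, !σ v) (mem_falsClause.2 ⟨hv, rfl⟩)
  simpa using this.symm

theorem Clause.FalsifiedBy.eq_falsClause {C : Clause V} {σ : V → Bool} (h : C.FalsifiedBy σ) :
    C = falsClause σ C.vars := by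
  apply Subtype.ext
  refine Finset.eq_of_subset_of_card_le (subset_falsClause_iff.2 ⟨subset_rfl, h⟩) ?_
  rw [card_falsClause, Clause.card_vars]

theorem card_filter_neg_falsClause (σ : V → Bool) (W : Finset V) :
    ((falsClause σ W).1.filter fun b => b.2 = false).card =
      (W.filter fun v => σ v = true).card := by
  symm
  refine Finset.card_bij (fun v _ => (v, false)) ?_ ?_ ?_
  · intro v hv
    simp only [Finset.mem_filter] at hv
    simp [mem_falsClause, hv]
  · intro a _ b _ h
    exact congrArg Prod.fst h
  · rintro ⟨v, b⟩ h
    simp only [Finset.mem_filter, mem_falsClause] at h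
    obtain ⟨⟨h1, h2⟩, rfl⟩ := h
    exact ⟨v, by simp_all, rfl⟩

theorem eq_emptyClause_of_vars {C : Clause V} (h : C.vars = ∅) : C = emptyClause V :=
  Subtype.ext (Finset.image_eq_empty.1 h)

/-- The two clauses that extend `C` by a variable `x` have `C` as their resolvent. -/
theorem isResolvent_falsClause {C : Clause V} {σ : V → Bool} (hC : C.FalsifiedBy σ) {x : V}
    (hx : x ∉ C.vars) :
    IsResolvent x (falsClause (Function.update σ x false) (insert x C.vars))
      (falsClause (Function.update σ x true) (insert x C.vars)) C := by
  refine ⟨mem_falsClause.2 (by simp), mem_falsClause.2 (by simp), ?_⟩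
  ext ⟨v, b⟩
  have key : (v, b) ∈ C.1 ↔ v ∈ C.vars ∧ b = !σ v := by
    conv_lhs => rw [hC.eq_falsClause]
    exact mem_falsClause
  rw [key]
  simp only [Finset.mem_union, Finset.mem_erase, mem_falsClause, Finset.mem_insert]
  by_cases hv : v = x
  · subst hv
    cases b <;> simp [hx]
  · simp [hv]

/-- An assignment that falsifies a resolvent falsifies one of the two premises. -/
theorem IsResolvent.exists_falsifiedBy {x : V} {A A' C : Clause V}
    (h : IsResolvent x A A' C) {M : Configuration V} (hA : A ∈ M) (hA' : A' ∈ M) {σ : V → Bool}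
    (hσ : C.FalsifiedBy σ) : ∃ B ∈ M, B.vars ⊆ insert x C.vars ∧ B.FalsifiedBy σ := by
  obtain ⟨-, -, h⟩ := h
  have h₁ : ∀ a ∈ A.1, a = (x, true) ∨ a ∈ C.1 := by
    intro a ha
    rw [h, Finset.mem_union, Finset.mem_erase]
    tauto
  have h₂ : ∀ a ∈ A'.1, a = (x, false) ∨ a ∈ C.1 := by
    intro a ha
    rw [h, Finset.mem_union, Finset.mem_erase (s := A'.1)]
    tauto
  have hv : ∀ (B : Clause V) (b : Bool), (∀ a ∈ B.1, a = (x, b) ∨ a ∈ C.1) →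
      B.vars ⊆ insert x C.vars := by
    intro B b hB v hv
    obtain ⟨a, ha, rfl⟩ := Finset.mem_image.1 hv
    rcases hB a ha with rfl | h
    · exact Finset.mem_insert_self _ _
    · exact Finset.mem_insert_of_mem (Clause.fst_mem_vars h)
  cases hx : σ x with
  | false =>
    refine ⟨A, hA, hv A _ h₁, fun a ha => ?_⟩
    rcases h₁ a ha with rfl | h
    · simp [hx]
    · exact hσ a h
  | true =>
    refine ⟨A', hA', hv A' _ h₂, fun a ha => ?_⟩
    rcases h₂ a ha with rfl | h
    · simp [hx]
    · exact hσ a h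

end Clauses

/-! ### Derivations of bounded width and space -/

section Chains

variable {V : Type*} [DecidableEq V]

/-- A sequence of derivation steps in which every configuration that is reached has only clauses of
width at most `w`, and at most `b` of them. The value `b = ⊤` imposes no bound on the space. -/
def Chain (F : CNF V) (w : ℕ) (b : ℕ∞) : Configuration V → Configuration V → Prop :=
  Relation.ReflTransGen fun M M' =>
    Step F M M' ∧ (∀ C ∈ M', C.1.card ≤ w) ∧ (M'.card : ℕ∞) ≤ b

variable {F : CNF V} {w : ℕ} {b : ℕ∞}

theorem Chain.width_le {M M' : Configuration V} (h : Chain F w b M M')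
    (hM : ∀ C ∈ M, C.1.card ≤ w) : ∀ C ∈ M', C.1.card ≤ w := by
  cases h with
  | refl => exact hM
  | tail _ h => exact h.2.1

/-- Any subset of the memory is reached by one erasure. -/
theorem Chain.erase {M M' : Configuration V} (h : M' ⊆ M) (hw : ∀ C ∈ M', C.1.card ≤ w)
    (hb : (M'.card : ℕ∞) ≤ b) : Chain F w b M M' := by
  refine Relation.ReflTransGen.single ⟨?_, hw, hb⟩
  have := Step.erasure (F := F) M (M \ M') Finset.sdiff_subset
  rwa [Finset.sdiff_sdiff_eq_self h] at this

theorem Chain.exists_refutation {M : Configuration V} (h : Chain F w b ∅ M)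
    (hM : emptyClause V ∈ M) :
    ∃ π : Refutation F, π.width ≤ w ∧ (π.space : ℕ∞) ≤ b := by
  have key : ∃ (len : ℕ) (conf : ℕ → Configuration V), conf 0 = ∅ ∧ conf len = M ∧
      (∀ t < len, Step F (conf t) (conf (t + 1))) ∧
      ∀ t ≤ len, (∀ C ∈ conf t, C.1.card ≤ w) ∧ ((conf t).card : ℕ∞) ≤ b := by
    clear hM
    induction h with
    | refl => exact ⟨0, fun _ => ∅, rfl, rfl, by simp, by simp⟩
    | @tail M M' _ h ih =>
      obtain ⟨len, conf, h0, hlen, hstep, hbd⟩ := ih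
      refine ⟨len + 1, fun t => if t ≤ len then conf t else M', by simp [h0], by simp, ?_, ?_⟩
      · intro t ht
        rcases (Nat.lt_succ_iff.1 ht).lt_or_eq with h' | rfl
        · simpa [h'.le, Nat.succ_le_of_lt h'] using hstep t h'
        · simpa [hlen] using h.1
      · intro t _
        by_cases h' : t ≤ len
        · simpa [h'] using hbd t h'
        · simpa [h'] using h.2
  obtain ⟨len, conf, h0, hlen, hstep, hbd⟩ := key
  refine ⟨⟨len, conf, h0, hstep, hlen ▸ hM⟩, ?_, ?_⟩
  · refine Finset.sup_le fun t ht => Finset.sup_le fun C hC => ?_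
    exact (hbd t (Nat.lt_succ_iff.1 (Finset.mem_range.1 ht))).1 C hC
  · obtain ⟨t, ht, h⟩ := Finset.exists_mem_eq_sup (Finset.range (len + 1)) (by simp)
      fun t => (conf t).card
    rw [Refutation.space]
    simp only
    rw [h]
    exact (hbd t (Nat.lt_succ_iff.1 (Finset.mem_range.1 ht))).2

theorem Refutation.card_le_width (π : Refutation F) {t : ℕ} (ht : t ≤ π.len) {C : Clause V}
    (hC : C ∈ π.conf t) : C.1.card ≤ π.width := by
  refine le_trans (Finset.le_sup (f := fun C : Clause V => C.1.card) hC) ?_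
  exact Finset.le_sup (f := fun t => (π.conf t).sup fun C : Clause V => C.1.card)
    (Finset.mem_range.2 (Nat.lt_succ_of_le ht))

theorem Refutation.card_le_space (π : Refutation F) {t : ℕ} (ht : t ≤ π.len) :
    (π.conf t).card ≤ π.space :=
  Finset.le_sup (f := fun t => (π.conf t).card) (Finset.mem_range.2 (Nat.lt_succ_of_le ht))

/-- Semantic completeness in small width and space: if every assignment that falsifies `C` falsifies
a clause in memory whose variables lie in `W`, then `C` is derived by a tree-like derivation that
queries the variables in `W` but not in `C`; at each level of the tree one clause is kept. -/
theorem chain_insert_of_forall {W : Finset V} (hW : W.card ≤ w) {C : Clause V} (hC : C.vars ⊆ W)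
    {M : Configuration V} (hM : ∀ B ∈ M, B.1.card ≤ w)
    (himp : ∀ σ, C.FalsifiedBy σ → ∃ B ∈ M, B.vars ⊆ W ∧ B.FalsifiedBy σ)
    (hb : ((M.card + (W \ C.vars).card + 2 : ℕ) : ℕ∞) ≤ b) :
    Chain F w b M (insert C M) := by
  induction hn : (W \ C.vars).card generalizing C M with
  | zero =>
    have hCW : C.vars = W := hC.antisymm (by simpa using hn)
    obtain ⟨σ, hσ⟩ := C.exists_falsifiedBy
    obtain ⟨B, hB, hBW, hBσ⟩ := himp σ hσ
    refine Relation.ReflTransGen.single ⟨Step.weakening M B C hB ?_, ?_, ?_⟩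
    · rw [hσ.eq_falsClause, hCW]
      exact subset_falsClause_iff.2 ⟨hBW, hBσ⟩
    · intro D hD
      rcases Finset.mem_insert.1 hD with rfl | hD
      · rw [← Clause.card_vars, hCW]; exact hW
      · exact hM D hD
    · refine le_trans (Nat.cast_le.2 ?_) hb
      have := Finset.card_insert_le C M
      omega
  | succ n ih =>
    rw [hn] at hb
    obtain ⟨x, hx⟩ : (W \ C.vars).Nonempty := by
      rw [← Finset.card_pos]; omega
    obtain ⟨hxW, hxC⟩ := Finset.mem_sdiff.1 hx
    obtain ⟨σ, hσ⟩ := C.exists_falsifiedBy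
    have hres := isResolvent_falsClause hσ hxC
    have hins : insert x C.vars ⊆ W := Finset.insert_subset hxW hC
    have hcard : (W \ insert x C.vars).card = n := by
      rw [Finset.sdiff_insert, Finset.card_erase_of_mem hx, hn]; rfl
    have hsub : ∀ i, C.1 ⊆ (falsClause (Function.update σ x i) (insert x C.vars)).1 := by
      intro i
      refine subset_falsClause_iff.2 ⟨Finset.subset_insert _ _, hσ.congr ?_⟩
      intro v hv
      rw [Function.update_of_ne]
      rintro rfl
      exact hxC hv
    have hwid : ∀ i, (falsClause (Function.update σ x i) (insert x C.vars)).1.card ≤ w := by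
      intro i
      rw [card_falsClause]
      exact (Finset.card_le_card hins).trans hW
    set C₀ := falsClause (Function.update σ x false) (insert x C.vars) with hC₀
    set C₁ := falsClause (Function.update σ x true) (insert x C.vars) with hC₁
    have hi₀ := Finset.card_insert_le C₀ M
    have hi₁ := Finset.card_insert_le C₁ (insert C₀ M)
    have hi₂ := Finset.card_insert_le C (insert C₁ (insert C₀ M))
    have hi₃ := Finset.card_insert_le C M
    have h₀ : Chain F w b M (insert C₀ M) := by
      refine ih (by rw [hC₀, vars_falsClause]; exact hins) hM
        (fun τ hτ => himp τ (hτ.mono (hsub false))) ?_ (by rw [hC₀, vars_falsClause, hcard])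
      rw [hC₀, vars_falsClause, hcard]
      exact le_trans (Nat.cast_le.2 (by omega)) hb
    have hM₀ := h₀.width_le hM
    have h₁ : Chain F w b (insert C₀ M) (insert C₁ (insert C₀ M)) := by
      refine ih (by rw [hC₁, vars_falsClause]; exact hins) hM₀
        (fun τ hτ => ?_) ?_ (by rw [hC₁, vars_falsClause, hcard])
      · obtain ⟨B, hB, hB'⟩ := himp τ (hτ.mono (hsub true))
        exact ⟨B, Finset.mem_insert_of_mem hB, hB'⟩
      · rw [hC₁, vars_falsClause, hcard]
        exact le_trans (Nat.cast_le.2 (by omega)) hb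
    have hM₁ := h₁.width_le hM₀
    have hCw : C.1.card ≤ w := (Finset.card_le_card (hsub false)).trans (hwid false)
    refine (h₀.trans h₁).trans (Relation.ReflTransGen.trans (Relation.ReflTransGen.single
      ⟨Step.resolution _ x C₀ C₁ C (by simp) (by simp) hres, ?_, ?_⟩) (Chain.erase ?_ ?_ ?_))
    · intro D hD
      rcases Finset.mem_insert.1 hD with rfl | hD
      · exact hCw
      · exact hM₁ D hD
    · exact le_trans (Nat.cast_le.2 (by omega)) hb
    · intro D hD
      simp only [Finset.mem_insert] at hD ⊢
      tauto
    · intro D hD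
      rcases Finset.mem_insert.1 hD with rfl | hD
      · exact hCw
      · exact hM D hD
    · exact le_trans (Nat.cast_le.2 (by omega)) hb

/-- Several clauses are derived one after the other, with the auxiliary clauses of each derivation
erased before the next; only `w + 2` clauses are needed in addition to the memory at the end. -/
theorem chain_union_of_forall {M L : Configuration V}
    (hM : ∀ B ∈ M, B.1.card ≤ w)
    (hL : ∀ C ∈ L, ∃ W : Finset V, W.card ≤ w ∧ C.vars ⊆ W ∧
      ∀ σ, C.FalsifiedBy σ → ∃ B ∈ M, B.vars ⊆ W ∧ B.FalsifiedBy σ)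
    (hb : (((M ∪ L).card + w + 2 : ℕ) : ℕ∞) ≤ b) :
    Chain F w b M (M ∪ L) := by
  induction L using Finset.induction_on with
  | empty => rw [Finset.union_empty]; exact Relation.ReflTransGen.refl
  | insert C L hC ih =>
    have hle : (M ∪ L).card ≤ (M ∪ insert C L).card :=
      Finset.card_le_card (Finset.union_subset_union_right (Finset.subset_insert _ _))
    have h₁ := ih (fun D hD => hL D (Finset.mem_insert_of_mem hD))
      (le_trans (Nat.cast_le.2 (by omega)) hb)
    refine h₁.trans ?_
    obtain ⟨W, hW, hCW, himp⟩ := hL C (Finset.mem_insert_self _ _)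
    rw [Finset.union_insert]
    refine chain_insert_of_forall hW hCW (h₁.width_le hM) (fun σ hσ => ?_) ?_
    · obtain ⟨B, hB, hB'⟩ := himp σ hσ
      exact ⟨B, Finset.mem_union_left _ hB, hB'⟩
    · have := Finset.card_le_card (Finset.sdiff_subset : W \ C.vars ⊆ W)
      exact le_trans (Nat.cast_le.2 (by omega)) hb

end Chains

/-! ### Parities and linear systems over the field with two elements -/

section Parity

variable {U V : Type*}

/-- The assignment to `U` that gives `u` the parity of the values of `σ` on `N u`. -/
def xorEval (N : U → Finset V) (σ : V → Bool) (u : U) : Bool :=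
  decide (Odd ((N u).filter fun v => σ v = true).card)

theorem ite_xorEval (N : U → Finset V) (σ : V → Bool) (u : U) :
    (if xorEval N σ u = true then 1 else 0 : ZMod 2) =
      ∑ v ∈ N u, if σ v = true then 1 else 0 := by
  rw [Finset.sum_boole]
  by_cases h : Odd ((N u).filter fun v => σ v = true).card
  · simp [xorEval, h, ZMod.natCast_eq_one_iff_odd.2 h]
  · simp [xorEval, h, ZMod.natCast_eq_zero_iff_even.2 (Nat.not_odd_iff_even.1 h)]

variable [DecidableEq V]

/-- The symmetric difference of the sets `N u`, `u ∈ T`. -/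
def xorSum [Fintype V] (N : U → Finset V) (T : Finset U) : Finset V :=
  Finset.univ.filter fun v => Odd (T.filter fun u => v ∈ N u).card

theorem mem_xorSum [Fintype V] {N : U → Finset V} {T : Finset U} {v : V} :
    v ∈ xorSum N T ↔ Odd (T.filter fun u => v ∈ N u).card := by
  simp [xorSum]

theorem xorSum_empty [Fintype V] (N : U → Finset V) : xorSum N ∅ = ∅ := by
  simp [xorSum]

theorem xorSum_singleton [Fintype V] (N : U → Finset V) (u : U) : xorSum N {u} = N u := by
  ext v
  rw [mem_xorSum, Finset.filter_singleton]
  split_ifs with h <;> simp [h]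

open scoped symmDiff in
theorem xorSum_symmDiff_subset [Fintype V] [DecidableEq U] (N : U → Finset V) (T T' : Finset U) :
    xorSum N (T ∆ T') ⊆ xorSum N T ∪ xorSum N T' := by
  intro v
  rw [Finset.mem_union, mem_xorSum, mem_xorSum, mem_xorSum]
  have h1 : (T ∆ T').filter (fun u => v ∈ N u) =
      (T.filter fun u => v ∈ N u) ∆ (T'.filter fun u => v ∈ N u) := by
    ext u
    simp only [Finset.mem_symmDiff, Finset.mem_filter]
    tauto
  rw [h1]
  generalize (T.filter fun u => v ∈ N u) = P
  generalize (T'.filter fun u => v ∈ N u) = P'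
  have h2 : (P ∆ P').card = (P \ P').card + (P' \ P).card :=
    Finset.card_union_of_disjoint disjoint_sdiff_sdiff
  have h3 := Finset.card_sdiff_add_card_inter P P'
  have h4 := Finset.card_sdiff_add_card_inter P' P
  rw [Finset.inter_comm] at h4
  rw [h2, Nat.odd_iff, Nat.odd_iff, Nat.odd_iff]
  omega

/-- Solvability of a linear system over the field with two elements: an assignment `σ` can be
changed outside `Y` so that the parities on `N u`, `u ∈ S`, take prescribed values `τ u`, if these
are already the parities under `σ` for every dependency among the equations, that is, for every
`T ⊆ S` whose equations sum to one that mentions variables in `Y` only. -/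
theorem exists_xorEval_eq [Fintype U] [DecidableEq U] [Fintype V] (N : U → Finset V)
    (Y : Finset V) (S : Finset U) (σ : V → Bool) (τ : U → Bool)
    (h : ∀ T ⊆ S, xorSum N T ⊆ Y → ∀ u ∈ T, τ u = xorEval N σ u) :
    ∃ σ' : V → Bool, (∀ v ∈ Y, σ' v = σ v) ∧ ∀ u ∈ S, xorEval N σ' u = τ u := by
  set z : Bool → ZMod 2 := fun b => if b = true then 1 else 0 with hz
  have z_inj : ∀ a b, z a = z b → a = b := by decide
  have z_decide : ∀ x : ZMod 2, z (decide (x = 1)) = x := by decide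
  -- `γ` is the change of `σ` outside `Y`, and `Φ γ` the resulting change of the parities.
  let Φ : (V → ZMod 2) →ₗ[ZMod 2] (U → ZMod 2) :=
    { toFun := fun γ u => if u ∈ S then ∑ v ∈ N u, if v ∈ Y then 0 else γ v else 0
      map_add' := by
        intro γ γ'
        ext u
        by_cases hu : u ∈ S
        · simp only [hu, if_true, Pi.add_apply, ← Finset.sum_add_distrib]
          refine Finset.sum_congr rfl fun v _ => ?_
          split_ifs <;> simp
        · simp [hu]
      map_smul' := by
        intro c γ
        ext u
        by_cases hu : u ∈ S
        · simp only [hu, if_true, Pi.smul_apply, RingHom.id_apply, smul_eq_mul, Finset.mul_sum]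
          refine Finset.sum_congr rfl fun v _ => ?_
          split_ifs <;> simp
        · simp [hu] }
  let b : U → ZMod 2 := fun u => if u ∈ S then z (τ u) - z (xorEval N σ u) else 0
  have hb : b ∈ LinearMap.range Φ := by
    by_contra hb
    -- A functional that vanishes on the range of `Φ` is the sum over a dependency `T ⊆ S`, and the
    -- prescribed change `b` is zero on `T` by assumption.
    obtain ⟨f, hfb, hf⟩ := Submodule.exists_le_ker_of_notMem hb
    set c : U → ZMod 2 := fun u => f (Pi.single u 1) with hc
    have hfc : ∀ g : U → ZMod 2, f g = ∑ u, g u * c u := by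
      intro g
      have := LinearMap.pi_apply_eq_sum_univ f g
      rw [this]
      refine Finset.sum_congr rfl fun u _ => ?_
      rw [smul_eq_mul, hc]
      congr 2
      ext i
      simp [Pi.single_apply, eq_comm]
    have hT : xorSum N (S.filter fun u => c u = 1) ⊆ Y := by
      intro v hv
      by_contra hvY
      have h0 : f (Φ (Pi.single v 1)) = 0 := hf ⟨_, rfl⟩
      have h1 : ∀ u, Φ (Pi.single v 1) u = if u ∈ S ∧ v ∈ N u then 1 else 0 := by
        intro u
        change (if u ∈ S then ∑ v' ∈ N u, if v' ∈ Y then 0 else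
          (Pi.single v 1 : V → ZMod 2) v' else 0) = _
        by_cases hu : u ∈ S
        · rw [if_pos hu]
          have : ∀ v' ∈ N u, (if v' ∈ Y then 0 else (Pi.single v 1 : V → ZMod 2) v') =
              if v' = v then 1 else 0 := by
            intro v' _
            by_cases hv' : v' = v
            · subst hv'; simp [hvY]
            · simp [hv']
          rw [Finset.sum_congr rfl this, Finset.sum_ite_eq']
          simp [hu]
        · simp [hu]
      rw [hfc] at h0
      rw [mem_xorSum, ← ZMod.natCast_eq_one_iff_odd, ← Finset.sum_boole, Finset.sum_filter] at hv
      rw [← Finset.sum_subset (Finset.subset_univ S) fun u _ hu => by rw [h1]; simp [hu]] at h0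
      refine one_ne_zero (hv.symm.trans (Eq.trans (Finset.sum_congr rfl fun u hu => ?_) h0))
      have h2 : ∀ x y : ZMod 2, (if x = 1 then y else 0) = y * x := by decide
      rw [h1, h2]
      simp [hu]
    have h1 := h _ (Finset.filter_subset _ _) hT
    refine hfb ?_
    rw [hfc]
    refine Finset.sum_eq_zero fun u _ => ?_
    by_cases hu : u ∈ S
    · by_cases hcu : c u = 1
      · simp [b, h1 u (Finset.mem_filter.2 ⟨hu, hcu⟩)]
      · have : ∀ x : ZMod 2, x ≠ 1 → x = 0 := by decide
        rw [this _ hcu, mul_zero]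
    · simp [b, hu]
  obtain ⟨γ, hγ⟩ := hb
  refine ⟨fun v => if v ∈ Y then σ v else decide (z (σ v) + γ v = 1), fun v hv => by simp [hv], ?_⟩
  intro u hu
  apply z_inj
  have h2 := congrFun hγ u
  change (if u ∈ S then ∑ v ∈ N u, if v ∈ Y then 0 else γ v else 0) =
    (if u ∈ S then z (τ u) - z (xorEval N σ u) else 0) at h2
  rw [if_pos hu, if_pos hu] at h2
  have h3 : z (xorEval N σ u) = ∑ v ∈ N u, z (σ v) := ite_xorEval N σ u
  rw [eq_sub_iff_add_eq, h3, ← Finset.sum_add_distrib] at h2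
  rw [← h2]
  refine (ite_xorEval N _ u).trans (Finset.sum_congr rfl fun v _ => ?_)
  change z _ = _
  by_cases hv : v ∈ Y
  · simp [hv]
  · rw [if_neg hv, if_neg hv, z_decide, add_comm]

end Parity

/-! ### Expansion and relevant variables -/

section Relevant

variable {U V : Type*} [Fintype V] [DecidableEq V]

/-- Expansion with respect to symmetric differences: any `t ≤ r` of the sets `N u` have a symmetric
difference with at least `4 * t` elements. -/
def IsXorExpander (N : U → Finset V) (r : ℕ) : Prop :=
  ∀ T : Finset U, T.card ≤ r → 4 * T.card ≤ (xorSum N T).card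

variable [Fintype U]

/-- The sets of at most `r` equations whose sum mentions variables in `Y` only. -/
def dependencies (N : U → Finset V) (r : ℕ) (Y : Finset V) : Finset (Finset U) :=
  Finset.univ.filter fun T => T.card ≤ r ∧ xorSum N T ⊆ Y

theorem mem_dependencies {N : U → Finset V} {r : ℕ} {Y : Finset V} {T : Finset U} :
    T ∈ dependencies N r Y ↔ T.card ≤ r ∧ xorSum N T ⊆ Y := by
  simp [dependencies]

variable [DecidableEq U]

/-- The variables in `U` on whose parities an assignment to `Y` may have an influence: those that
occur in a set of at most `r` equations whose sum mentions variables in `Y` only. -/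
def relevant (N : U → Finset V) (r : ℕ) (Y : Finset V) : Finset U :=
  (dependencies N r Y).biUnion id

theorem mem_relevant {N : U → Finset V} {r : ℕ} {Y : Finset V} {u : U} :
    u ∈ relevant N r Y ↔ ∃ T, (T.card ≤ r ∧ xorSum N T ⊆ Y) ∧ u ∈ T := by
  simp [relevant, mem_dependencies]

theorem relevant_mono (N : U → Finset V) (r : ℕ) {Y Y' : Finset V} (h : Y ⊆ Y') :
    relevant N r Y ⊆ relevant N r Y' := by
  intro u hu
  rw [mem_relevant] at hu ⊢
  obtain ⟨T, ⟨hr, hT⟩, hu⟩ := hu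
  exact ⟨T, ⟨hr, hT.trans h⟩, hu⟩

theorem mem_relevant_of_subset {N : U → Finset V} {r : ℕ} (hr : 1 ≤ r) {Y : Finset V} {u : U}
    (h : N u ⊆ Y) : u ∈ relevant N r Y :=
  mem_relevant.2 ⟨{u}, ⟨by simpa using hr, by rwa [xorSum_singleton]⟩, by simp⟩

theorem relevant_empty {N : U → Finset V} {r : ℕ} (hN : IsXorExpander N r) :
    relevant N r ∅ = ∅ := by
  rw [Finset.eq_empty_iff_forall_notMem]
  intro u hu
  obtain ⟨T, ⟨hr, hT⟩, hu⟩ := mem_relevant.1 hu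
  have h1 := hN T hr
  rw [Finset.subset_empty.1 hT, Finset.card_empty] at h1
  have := Finset.card_pos.2 ⟨u, hu⟩
  omega

open scoped symmDiff in
/-- The dependencies form a linear code over the field with two elements: each relevant `u` lies
in exactly half of them. As each has at most `|Y| / 4` elements by expansion, there are at most
`|Y| / 2` relevant variables. -/
theorem two_mul_card_relevant_le {N : U → Finset V} {r : ℕ} (hN : IsXorExpander N r)
    {Y : Finset V} (hY : Y.card ≤ r) : 2 * (relevant N r Y).card ≤ Y.card := by
  have hsmall : ∀ T ∈ dependencies N r Y, 4 * T.card ≤ Y.card := by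
    intro T hT
    obtain ⟨h1, h2⟩ := mem_dependencies.1 hT
    exact (hN T h1).trans (Finset.card_le_card h2)
  -- The sum of two dependencies has at most `|Y| / 4 + |Y| / 4 ≤ r` elements.
  have hadd : ∀ T ∈ dependencies N r Y, ∀ T' ∈ dependencies N r Y, T ∆ T' ∈ dependencies N r Y := by
    intro T hT T' hT'
    have h1 := hsmall T hT
    have h2 := hsmall T' hT'
    refine mem_dependencies.2 ⟨?_, (xorSum_symmDiff_subset N T T').trans
      (Finset.union_subset (mem_dependencies.1 hT).2 (mem_dependencies.1 hT').2)⟩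
    have h3 : (T ∆ T').card ≤ T.card + T'.card :=
      (Finset.card_le_card Finset.symmDiff_subset_union).trans (Finset.card_union_le _ _)
    omega
  have hhalf : ∀ u ∈ relevant N r Y,
      2 * ((dependencies N r Y).filter fun T => u ∈ T).card = (dependencies N r Y).card := by
    intro u hu
    obtain ⟨T₀, hT₀, hu⟩ := mem_relevant.1 hu
    rw [← mem_dependencies] at hT₀
    -- Adding a dependency that contains `u` exchanges those with `u` and those without `u`.
    have h1 : ((dependencies N r Y).filter fun T => u ∈ T).card =
        ((dependencies N r Y).filter fun T => ¬ u ∈ T).card := by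
      refine Finset.card_nbij' (fun T => T ∆ T₀) (fun T => T ∆ T₀) ?_ ?_ ?_ ?_
      · intro T hT
        simp only [Finset.coe_filter, Set.mem_ofPred_eq] at hT ⊢
        refine ⟨hadd T hT.1 T₀ hT₀, ?_⟩
        simp [Finset.mem_symmDiff, hT.2, hu]
      · intro T hT
        simp only [Finset.coe_filter, Set.mem_ofPred_eq] at hT ⊢
        refine ⟨hadd T hT.1 T₀ hT₀, ?_⟩
        simp [Finset.mem_symmDiff, hT.2, hu]
      · intro T _
        exact symmDiff_symmDiff_cancel_right _ _
      · intro T _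
        exact symmDiff_symmDiff_cancel_right _ _
    have h2 := Finset.card_filter_add_card_filter_not (s := dependencies N r Y) (fun T => u ∈ T)
    omega
  have hne : 0 < (dependencies N r Y).card :=
    Finset.card_pos.2 ⟨∅, mem_dependencies.2 ⟨by simp, by simp [xorSum_empty]⟩⟩
  have hsum : ∑ u ∈ relevant N r Y, ((dependencies N r Y).filter fun T => u ∈ T).card =
      ∑ T ∈ dependencies N r Y, ((relevant N r Y).filter fun u => u ∈ T).card :=
    Finset.sum_card_bipartiteAbove_eq_sum_card_bipartiteBelow (fun u T => u ∈ T)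
  have h1 : (relevant N r Y).card * (dependencies N r Y).card =
      2 * ∑ u ∈ relevant N r Y, ((dependencies N r Y).filter fun T => u ∈ T).card := by
    rw [Finset.mul_sum, Finset.sum_congr rfl hhalf, Finset.sum_const, smul_eq_mul]
  have h2 : 4 * ∑ T ∈ dependencies N r Y, ((relevant N r Y).filter fun u => u ∈ T).card ≤
      (dependencies N r Y).card * Y.card := by
    rw [Finset.mul_sum, ← smul_eq_mul, ← Finset.sum_const]
    refine Finset.sum_le_sum fun T hT => le_trans (Nat.mul_le_mul_left 4 ?_) (hsmall T hT)
    exact Finset.card_le_card fun u hu => (Finset.mem_filter.1 hu).2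
  rw [← hsum] at h2
  refine Nat.le_of_mul_le_mul_left ?_ hne
  calc (dependencies N r Y).card * (2 * (relevant N r Y).card)
      = 2 * ((relevant N r Y).card * (dependencies N r Y).card) := by ring
    _ ≤ _ := by rw [h1]; linarith

/-- The values of `σ` on `Y` constrain the parities of a few sets `N u` only through the relevant
variables of `Y`. -/
theorem exists_xorEval_eq_of_relevant {N : U → Finset V} {r : ℕ} {Y : Finset V} {S : Finset U}
    (hS : S.card ≤ r) {σ : V → Bool} {τ : U → Bool}
    (h : ∀ u ∈ relevant N r Y, τ u = xorEval N σ u) :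
    ∃ σ' : V → Bool, (∀ v ∈ Y, σ' v = σ v) ∧ ∀ u ∈ S, xorEval N σ' u = τ u :=
  exists_xorEval_eq N Y S σ τ fun T hT hTY u hu =>
    h u (mem_relevant.2 ⟨T, ⟨(Finset.card_le_card hT).trans hS, hTY⟩, hu⟩)

end Relevant

/-! ### Clauses of the XORification -/

section Xorify

variable {U V : Type*} [Fintype V] [DecidableEq V]

theorem isXorLiteralClause_falsClause (G : SimpleGraph (U ⊕ V)) (a : Literal U) (σ : V → Bool) :
    IsXorLiteralClause G a (falsClause σ (nbhd G a.1)) ↔ a.2 = !xorEval (nbhd G) σ a.1 := by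
  rw [IsXorLiteralClause, vars_falsClause, card_filter_neg_falsClause, xorEval,
    ← Nat.not_odd_iff_even]
  by_cases h : Odd ((nbhd G a.1).filter fun v => σ v = true).card <;>
    cases h2 : a.2 <;> simp [h]

theorem mem_xorify_iff (G : SimpleGraph (U ⊕ V)) {F : CNF U} {E : Clause V} :
    E ∈ xorify G F ↔ ∃ C ∈ F, E ∈ xorClause G C := by
  simp [xorify]

variable [DecidableEq U]

/-- The clauses of an XORified clause, described by the assignments that falsify them. -/
theorem mem_xorClause_iff (G : SimpleGraph (U ⊕ V)) {C : Clause U} {E : Clause V} :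
    E ∈ xorClause G C ↔ E.vars = C.vars.biUnion (nbhd G) ∧
      ∀ σ, E.FalsifiedBy σ → C.FalsifiedBy (xorEval (nbhd G) σ) := by
  simp only [xorClause, Finset.mem_filter, Finset.mem_univ, true_and]
  constructor
  · rintro ⟨f, hf, hE⟩
    refine ⟨?_, fun σ hσ a ha => ?_⟩
    · have : E.vars = C.1.biUnion fun a => (f a).vars := by
        rw [Clause.vars, hE, Finset.biUnion_image]
        rfl
      rw [this, Clause.vars, Finset.image_biUnion]
      exact Finset.biUnion_congr rfl fun a ha => (hf a ha).1
    · have h1 : (f a).FalsifiedBy σ := by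
        refine hσ.mono ?_
        rw [hE]
        exact Finset.subset_biUnion_of_mem (fun a => (f a).1) ha
      have h2 := hf a ha
      have h3 : f a = falsClause σ (nbhd G a.1) := by
        rw [← h2.1]
        exact h1.eq_falsClause
      rw [h3] at h2
      exact (isXorLiteralClause_falsClause G a σ).1 h2
  · rintro ⟨hE, h⟩
    obtain ⟨σ, hσ⟩ := E.exists_falsifiedBy
    refine ⟨fun a => falsClause σ (nbhd G a.1),
      fun a ha => (isXorLiteralClause_falsClause G a σ).2 (h σ hσ a ha), ?_⟩
    conv_lhs => rw [hσ.eq_falsClause, hE]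
    ext b
    simp only [mem_falsClause, Finset.mem_biUnion, Clause.vars, Finset.mem_image]
    constructor
    · rintro ⟨⟨u, ⟨a, ha, rfl⟩, hb⟩, hb'⟩
      exact ⟨a, ha, hb, hb'⟩
    · rintro ⟨a, ha, hb, hb'⟩
      exact ⟨⟨a.1, ⟨a, ha, rfl⟩, hb⟩, hb'⟩

end Xorify

/-! ### Translation of refutations -/

section Condensation

variable {U V : Type*} [DecidableEq U] [Fintype V] [DecidableEq V]

theorem falsClause_mem_xorClause (G : SimpleGraph (U ⊕ V)) {C : Clause U} {σ : V → Bool}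
    (h : C.FalsifiedBy (xorEval (nbhd G) σ)) :
    falsClause σ (C.vars.biUnion (nbhd G)) ∈ xorClause G C := by
  refine (mem_xorClause_iff G).2 ⟨vars_falsClause _ _, fun τ hτ => h.congr fun u hu => ?_⟩
  have : ∀ v ∈ nbhd G u, τ v = σ v := fun v hv =>
    hτ.eq_of_mem v (Finset.mem_biUnion.2 ⟨u, hu, hv⟩)
  rw [xorEval, xorEval, Finset.filter_congr fun v hv => by rw [this v hv]]

/-- XORification with at most `d` variables for each variable maps refutations of width `k` to
refutations of width `d * (k + 1)`: every clause `C` in memory is replaced by its XORification. The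
extra `d` makes room for the variables substituted for the variable that is resolved upon. -/
theorem exists_refutation_xorify {G : SimpleGraph (U ⊕ V)} {F : CNF U} {d k : ℕ}
    (hd : ∀ u, (nbhd G u).card ≤ d) (π : Refutation F) (hπ : π.width ≤ k) :
    ∃ π' : Refutation (xorify G F), π'.width ≤ d * (k + 1) := by
  have hvars : ∀ P : Finset U, (P.biUnion (nbhd G)).card ≤ P.card * d := fun P =>
    Finset.card_biUnion_le_card_mul _ _ _ fun u _ => hd u
  set X : Configuration U → Configuration V := fun M => M.biUnion (xorClause G) with hX
  have hXw : ∀ M : Configuration U, (∀ C ∈ M, C.1.card ≤ k) → ∀ E ∈ X M,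
      E.1.card ≤ d * (k + 1) := by
    intro M hM E hE
    obtain ⟨C, hC, hE⟩ := Finset.mem_biUnion.1 hE
    rw [← Clause.card_vars, ((mem_xorClause_iff G).1 hE).1]
    refine (hvars _).trans ?_
    rw [mul_comm d]
    refine Nat.mul_le_mul_right d ?_
    rw [Clause.card_vars]
    exact (hM C hC).trans (Nat.le_succ k)
  have hmain : ∀ t ≤ π.len, Chain (xorify G F) (d * (k + 1)) ⊤ ∅ (X (π.conf t)) := by
    intro t
    induction t with
    | zero =>
      intro _
      rw [π.conf_zero]
      exact Relation.ReflTransGen.refl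
    | succ t ih =>
      intro ht
      have hwt : ∀ C ∈ π.conf t, C.1.card ≤ k :=
        fun C hC => (π.card_le_width (by omega) hC).trans hπ
      have hwt' : ∀ C ∈ π.conf (t + 1), C.1.card ≤ k :=
        fun C hC => (π.card_le_width ht hC).trans hπ
      refine (ih (by omega)).trans ?_
      have hstep := π.step t (by omega)
      revert hstep hwt hwt'
      generalize π.conf t = M
      generalize π.conf (t + 1) = M'
      intro hM hM' hstep
      have hXins : ∀ C, X (insert C M) = X M ∪ xorClause G C := by
        intro C
        rw [hX]
        simp only
        rw [Finset.biUnion_insert, Finset.union_comm]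
      cases hstep with
      | download C hC =>
        have hCk := hM' C (Finset.mem_insert_self _ _)
        have : ∀ L ⊆ xorClause G C, Chain (xorify G F) (d * (k + 1)) ⊤ (X M) (X M ∪ L) := by
          intro L
          induction L using Finset.induction_on with
          | empty => intro _; rw [Finset.union_empty]; exact Relation.ReflTransGen.refl
          | insert E L hE ih =>
            intro hL
            rw [Finset.union_insert]
            refine (ih fun D hD => hL (Finset.mem_insert_of_mem hD)).tail
              ⟨Step.download _ E ((mem_xorify_iff G).2
                ⟨C, hC, hL (Finset.mem_insert_self _ _)⟩), ?_, le_top⟩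
            intro D hD
            refine hXw _ hM' D ?_
            rw [hXins]
            rw [← Finset.union_insert] at hD
            exact Finset.union_subset_union_right hL hD
        rw [hXins]
        exact this _ subset_rfl
      | weakening B C hB hBC =>
        rw [hXins]
        refine chain_union_of_forall (hXw M hM) (fun E hE => ?_) le_top
        have hEw := hXw _ hM' E (Finset.mem_biUnion.2 ⟨C, Finset.mem_insert_self _ _, hE⟩)
        rw [← Clause.card_vars] at hEw
        obtain ⟨hE₁, hE₂⟩ := (mem_xorClause_iff G).1 hE
        refine ⟨E.vars, hEw, subset_rfl, fun σ hσ => ?_⟩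
        have hB' := (hE₂ σ hσ).mono hBC
        refine ⟨falsClause σ (B.vars.biUnion (nbhd G)), Finset.mem_biUnion.2 ⟨B, hB,
          falsClause_mem_xorClause G hB'⟩, ?_, falsClause_falsifiedBy _ _⟩
        rw [vars_falsClause, hE₁]
        exact Finset.biUnion_subset_biUnion_of_subset_left _ (Clause.vars_mono hBC)
      | resolution x A A' C hA hA' hC =>
        rw [hXins]
        refine chain_union_of_forall (hXw M hM) (fun E hE => ?_) le_top
        obtain ⟨hE₁, hE₂⟩ := (mem_xorClause_iff G).1 hE
        have hW : ((insert x C.vars).biUnion (nbhd G)).card ≤ d * (k + 1) := by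
          refine (hvars _).trans ?_
          rw [mul_comm d]
          refine Nat.mul_le_mul_right d ((Finset.card_insert_le _ _).trans ?_)
          rw [Clause.card_vars]
          exact Nat.succ_le_succ (hM' C (Finset.mem_insert_self _ _))
        refine ⟨(insert x C.vars).biUnion (nbhd G), hW, ?_, fun σ hσ => ?_⟩
        · rw [hE₁]
          exact Finset.biUnion_subset_biUnion_of_subset_left _ (Finset.subset_insert _ _)
        · obtain ⟨B, hB, hBv, hBσ⟩ := hC.exists_falsifiedBy hA hA' (hE₂ σ hσ)
          refine ⟨falsClause σ (B.vars.biUnion (nbhd G)), Finset.mem_biUnion.2 ⟨B, hB,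
            falsClause_mem_xorClause G hBσ⟩, ?_, falsClause_falsifiedBy _ _⟩
          rw [vars_falsClause]
          exact Finset.biUnion_subset_biUnion_of_subset_left _ hBv
      | erasure M' h =>
        refine Chain.erase (Finset.biUnion_subset_biUnion_of_subset_left _ Finset.sdiff_subset)
          (hXw _ hM') le_top
  obtain ⟨π', hπ', -⟩ := (hmain π.len le_rfl).exists_refutation (Finset.mem_biUnion.2
    ⟨emptyClause U, π.emptyClause_mem, (mem_xorClause_iff G).2 ⟨by simp [emptyClause, Clause.vars],
      fun σ _ a ha => by simp [emptyClause] at ha⟩⟩)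
  exact ⟨π', hπ'⟩

/-- The clauses over the relevant variables of `D` that represent `D`: those that are false under
the assignment to `U` induced by some assignment that falsifies `D`. -/
noncomputable def unlift [Fintype U] (N : U → Finset V) (r : ℕ) (D : Clause V) :
    Configuration U :=
  open Classical in (Finset.univ.filter fun σ : V → Bool => D.FalsifiedBy σ).image fun σ =>
    falsClause (xorEval N σ) (relevant N r D.vars)

theorem mem_unlift [Fintype U] {N : U → Finset V} {r : ℕ} {D : Clause V} {E : Clause U} :
    E ∈ unlift N r D ↔
      ∃ σ, D.FalsifiedBy σ ∧ falsClause (xorEval N σ) (relevant N r D.vars) = E := by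
  simp [unlift]

theorem card_unlift_le [Fintype U] (N : U → Finset V) (r : ℕ) (D : Clause V) :
    (unlift N r D).card ≤ 2 ^ (relevant N r D.vars).card := by
  rw [← Finset.card_powerset]
  refine Finset.card_le_card_of_injOn
    (fun E => (relevant N r D.vars).filter fun u => (u, true) ∈ E.1) (fun E _ => ?_) ?_
  · exact Finset.mem_coe.2 (Finset.mem_powerset.2 (Finset.filter_subset _ _))
  · intro E hE E' hE' h
    obtain ⟨σ, -, rfl⟩ := mem_unlift.1 hE
    obtain ⟨σ', -, rfl⟩ := mem_unlift.1 hE'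
    refine falsClause_congr fun u hu => ?_
    have := Finset.ext_iff.1 h u
    simp only [Finset.mem_filter, hu, true_and, mem_falsClause] at this
    cases h1 : xorEval N σ u <;> cases h2 : xorEval N σ' u <;> simp_all

/-- A refutation of the XORification with respect to an expander is translated into a refutation of
the original formula: a configuration `M` becomes the set of all clauses that represent a clause of
`M`. -/
theorem exists_refutation_of_xorify [Fintype U] {G : SimpleGraph (U ⊕ V)} {F : CNF U} {w r : ℕ}
    (hG : IsXorExpander (nbhd G) r) (hr : w + 1 ≤ r)
    (π : Refutation (xorify G F)) (hπ : π.width ≤ w) :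
    ∃ π' : Refutation F, π'.width ≤ w ∧ π'.space ≤ π.space * 2 ^ w + w + 3 := by
  obtain ⟨K, hK⟩ : ∃ K, π.space * 2 ^ w = K := ⟨_, rfl⟩
  rw [hK]
  set N := nbhd G with hN
  have hrel : ∀ Y : Finset V, Y.card ≤ w + 1 → (relevant N r Y).card ≤ w := by
    intro Y hY
    have := two_mul_card_relevant_le hG (hY.trans hr)
    omega
  have hrelD : ∀ D : Clause V, D.1.card ≤ w → (relevant N r D.vars).card ≤ w := by
    intro D hD
    rw [← Clause.card_vars] at hD
    exact hrel _ (by omega)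
  set X : Configuration V → Configuration U := fun M => M.biUnion (unlift N r) with hX
  have hXins : ∀ C M, X (insert C M) = X M ∪ unlift N r C := by
    intro C M
    rw [hX]
    simp only
    rw [Finset.biUnion_insert, Finset.union_comm]
  have hXw : ∀ M : Configuration V, (∀ C ∈ M, C.1.card ≤ w) → ∀ E ∈ X M, E.1.card ≤ w := by
    intro M hM E hE
    obtain ⟨D, hD, hE⟩ := Finset.mem_biUnion.1 hE
    obtain ⟨σ, -, rfl⟩ := mem_unlift.1 hE
    rw [card_falsClause]
    exact hrelD D (hM D hD)
  have hXs : ∀ M : Configuration V, (∀ C ∈ M, C.1.card ≤ w) → M.card ≤ π.space →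
      (X M).card ≤ K := by
    intro M hM hs
    rw [← hK]
    refine (Finset.card_biUnion_le_card_mul _ _ (2 ^ w) fun D hD => ?_).trans
      (Nat.mul_le_mul_right _ hs)
    exact (card_unlift_le N r D).trans (Nat.pow_le_pow_right (by norm_num) (hrelD D (hM D hD)))
  have hmain : ∀ t ≤ π.len,
      Chain F w ((K + w + 3 : ℕ) : ℕ∞) ∅ (X (π.conf t)) := by
    intro t
    induction t with
    | zero =>
      intro _
      rw [π.conf_zero]
      exact Relation.ReflTransGen.refl
    | succ t ih =>
      intro ht
      have hM : ∀ C ∈ π.conf t, C.1.card ≤ w :=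
        fun C hC => (π.card_le_width (by omega) hC).trans hπ
      have hM' : ∀ C ∈ π.conf (t + 1), C.1.card ≤ w :=
        fun C hC => (π.card_le_width ht hC).trans hπ
      have hs := hXs _ hM (π.card_le_space (by omega))
      have hs' := hXs _ hM' (π.card_le_space ht)
      refine (ih (by omega)).trans ?_
      have hstep := π.step t (by omega)
      revert hstep hM hM' hs hs'
      generalize π.conf t = M
      generalize π.conf (t + 1) = M'
      intro hM hM' hs hs' hstep
      cases hstep with
      | download D hD =>
        obtain ⟨C, hC, hD⟩ := (mem_xorify_iff G).1 hD
        obtain ⟨hD₁, hD₂⟩ := (mem_xorClause_iff G).1 hD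
        have hDw := hrelD D (hM' D (Finset.mem_insert_self _ _))
        have hCvars : C.vars ⊆ relevant N r D.vars := by
          intro u hu
          refine mem_relevant_of_subset (by omega) ?_
          rw [hD₁]
          exact Finset.subset_biUnion_of_mem (nbhd G) hu
        rw [hXins] at hs' ⊢
        have hMC : ∀ B ∈ insert C (X M), B.1.card ≤ w := by
          intro B hB
          rcases Finset.mem_insert.1 hB with rfl | hB
          · rw [← Clause.card_vars]
            exact (Finset.card_le_card hCvars).trans hDw
          · exact hXw M hM B hB
        -- Beyond the `w + 2` clauses of the tree-like derivations, the downloaded clause `C` takes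
        -- one more unit of space until it is erased.
        have h1 := Finset.card_insert_le C (X M)
        have h2 := Finset.card_insert_le C (X M ∪ unlift N r D)
        refine (Relation.ReflTransGen.single
          ⟨Step.download (X M) C hC, hMC, Nat.cast_le.2 (by omega)⟩ : Chain F w _ _ _).trans
          ((chain_union_of_forall (L := unlift N r D) hMC ?_ ?_).trans
            (Chain.erase ?_ ?_ ?_))
        · intro E hE
          obtain ⟨σ, hσ, rfl⟩ := mem_unlift.1 hE
          refine ⟨relevant N r D.vars, hDw, (vars_falsClause _ _).subset, fun τ hτ =>
            ⟨C, Finset.mem_insert_self _ _, hCvars, ?_⟩⟩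
          exact hτ.mono (subset_falsClause_iff.2 ⟨hCvars, hD₂ σ hσ⟩)
        · rw [Finset.insert_union]
          exact Nat.cast_le.2 (by omega)
        · exact Finset.union_subset_union_left (Finset.subset_insert _ _)
        · intro B hB
          exact hXw _ hM' B (by rwa [hXins])
        · exact Nat.cast_le.2 (by omega)
      | weakening B D hB hBD =>
        have hDw := hrelD D (hM' D (Finset.mem_insert_self _ _))
        rw [hXins] at hs' ⊢
        refine chain_union_of_forall (hXw M hM) (fun E hE => ?_)
          (Nat.cast_le.2 (by omega))
        obtain ⟨σ, hσ, rfl⟩ := mem_unlift.1 hE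
        have hsub := relevant_mono N r (Clause.vars_mono hBD)
        refine ⟨relevant N r D.vars, hDw, (vars_falsClause _ _).subset, fun τ hτ =>
          ⟨falsClause (xorEval N σ) (relevant N r B.vars),
            Finset.mem_biUnion.2 ⟨B, hB, mem_unlift.2 ⟨σ, hσ.mono hBD, rfl⟩⟩,
            (vars_falsClause _ _).subset.trans hsub, hτ.mono ?_⟩⟩
        exact subset_falsClause_iff.2 ⟨(vars_falsClause _ _).subset.trans hsub,
          falsClause_falsifiedBy _ _⟩
      | resolution x A A' D hA hA' hD =>
        have hDw : (insert x D.vars).card ≤ w + 1 := by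
          have := hM' D (Finset.mem_insert_self _ _)
          rw [← Clause.card_vars] at this
          exact (Finset.card_insert_le _ _).trans (by omega)
        have hW := hrel _ hDw
        rw [hXins] at hs' ⊢
        refine chain_union_of_forall (hXw M hM) (fun E hE => ?_)
          (Nat.cast_le.2 (by omega))
        obtain ⟨σ, hσ, rfl⟩ := mem_unlift.1 hE
        refine ⟨relevant N r (insert x D.vars), hW, (vars_falsClause _ _).subset.trans
          (relevant_mono N r (Finset.subset_insert _ _)), fun τ hτ => ?_⟩
        -- As `τ` agrees with the parities of `σ` on the variables that are relevant for `D`, there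
        -- is an assignment that has the parities `τ` and falsifies `D`. It falsifies `A` or `A'`.
        obtain ⟨σ', hσ', hτ'⟩ := exists_xorEval_eq_of_relevant (Y := D.vars)
          (S := relevant N r (insert x D.vars)) (by omega) (σ := σ) (τ := τ) hτ.eq_of_mem
        obtain ⟨B, hB, hBv, hBσ⟩ := hD.exists_falsifiedBy hA hA' (hσ.congr hσ')
        have hsub := relevant_mono N r hBv
        refine ⟨falsClause (xorEval N σ') (relevant N r B.vars),
          Finset.mem_biUnion.2 ⟨B, hB, mem_unlift.2 ⟨σ', hBσ, rfl⟩⟩,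
          (vars_falsClause _ _).subset.trans hsub, ?_⟩
        refine (falsClause_falsifiedBy _ _).congr fun u hu => (hτ' u (hsub ?_)).symm
        rwa [vars_falsClause] at hu
      | erasure M' h =>
        refine Chain.erase (Finset.biUnion_subset_biUnion_of_subset_left _ Finset.sdiff_subset)
          (hXw _ hM') (Nat.cast_le.2 (by omega))
  obtain ⟨π', hπ', hs⟩ := (hmain π.len le_rfl).exists_refutation (Finset.mem_biUnion.2
    ⟨emptyClause V, π.emptyClause_mem, by
      obtain ⟨σ, hσ⟩ := (emptyClause V).exists_falsifiedBy
      refine mem_unlift.2 ⟨σ, hσ, eq_emptyClause_of_vars ?_⟩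
      rw [vars_falsClause]
      exact relevant_empty hG⟩)
  exact ⟨π', hπ', Nat.cast_le.1 hs⟩

end Condensation

/-! ### XORification with respect to a matching -/

section Matching

/-- A map of clauses that is compatible with the derivation rules does not increase the width and
the space of refutations. A resolution step may become a weakening step. -/
theorem exists_refutation_map {V V' : Type*} [DecidableEq V] [DecidableEq V'] {F : CNF V}
    {F' : CNF V'} (h : Clause V → Clause V') (hempty : h (emptyClause V) = emptyClause V')
    (hF : ∀ C ∈ F, h C ∈ F') (hmono : ∀ C D : Clause V, C.1 ⊆ D.1 → (h C).1 ⊆ (h D).1)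
    (hcard : ∀ C, (h C).1.card ≤ C.1.card)
    (hres : ∀ x A A' D, IsResolvent x A A' D →
      (∃ y, IsResolvent y (h A) (h A') (h D)) ∨ (h A).1 ⊆ (h D).1)
    (π : Refutation F) :
    ∃ π' : Refutation F', π'.width ≤ π.width ∧ π'.space ≤ π.space := by
  have hstep : ∀ M M', Step F M M' → Step F' (M.image h) (M'.image h) := by
    intro M M' hM
    cases hM with
    | download C hC =>
      rw [Finset.image_insert]
      exact Step.download _ _ (hF C hC)
    | weakening B D hB hD =>
      rw [Finset.image_insert]
      exact Step.weakening _ _ _ (Finset.mem_image_of_mem h hB) (hmono B D hD)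
    | resolution x A A' D hA hA' hD =>
      rw [Finset.image_insert]
      rcases hres x A A' D hD with ⟨y, hy⟩ | hy
      · exact Step.resolution _ y _ _ _ (Finset.mem_image_of_mem h hA)
          (Finset.mem_image_of_mem h hA') hy
      · exact Step.weakening _ _ _ (Finset.mem_image_of_mem h hA) hy
    | erasure M' hM' =>
      have hsub : (M \ M').image h ⊆ M.image h := Finset.image_subset_image Finset.sdiff_subset
      have := Step.erasure (F := F') (M.image h) (M.image h \ (M \ M').image h)
        Finset.sdiff_subset
      rwa [Finset.sdiff_sdiff_eq_self hsub] at this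
  refine ⟨⟨π.len, fun t => (π.conf t).image h, by simp [π.conf_zero],
    fun t ht => hstep _ _ (π.step t ht),
    Finset.mem_image.2 ⟨_, π.emptyClause_mem, hempty⟩⟩, ?_, ?_⟩
  · refine Finset.sup_le fun t ht => Finset.sup_le fun C hC => ?_
    obtain ⟨D, hD, rfl⟩ := Finset.mem_image.1 hC
    exact (hcard D).trans (π.card_le_width (Nat.lt_succ_iff.1 (Finset.mem_range.1 ht)) hD)
  · refine Finset.sup_le fun t ht => Finset.card_image_le.trans ?_
    exact π.card_le_space (Nat.lt_succ_iff.1 (Finset.mem_range.1 ht))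

variable {U V : Type*}

theorem renameLiteral_injective (f : U ↪ V) :
    Function.Injective fun a : Literal U => ((f a.1, a.2) : Literal V) := by
  intro a b h
  simp only [Prod.mk.injEq, EmbeddingLike.apply_eq_iff_eq] at h
  exact Prod.ext h.1 h.2

/-- Renaming of variables in a clause. -/
def Clause.rename [DecidableEq V] (f : U ↪ V) (C : Clause U) : Clause V :=
  ⟨C.1.image fun a => (f a.1, a.2), by
    intro v h h'
    simp only [Finset.mem_image, Prod.mk.injEq, Prod.exists] at h h'
    obtain ⟨u, b, h, rfl, rfl⟩ := h
    obtain ⟨u', b', h', hu, rfl⟩ := h'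
    rw [f.injective hu] at h'
    exact C.2 u h h'⟩

/-- Inverse renaming, which drops the literals whose variables are not in the range of `f`. -/
noncomputable def Clause.unrename (f : U ↪ V) (D : Clause V) : Clause U :=
  ⟨D.1.preimage (fun a => (f a.1, a.2)) (renameLiteral_injective f).injOn,
    fun u h h' => D.2 (f u)
      ((Finset.mem_preimage (f := fun a : Literal U => ((f a.1, a.2) : Literal V))).1 h)
      ((Finset.mem_preimage (f := fun a : Literal U => ((f a.1, a.2) : Literal V))).1 h')⟩

theorem Clause.mem_rename [DecidableEq V] {f : U ↪ V} {C : Clause U} {b : Literal V} :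
    b ∈ (C.rename f).1 ↔ ∃ a ∈ C.1, (f a.1, a.2) = b := by
  simp only [Clause.rename, Finset.mem_image]

theorem Clause.mk_mem_rename [DecidableEq V] {f : U ↪ V} {C : Clause U} {u : U} {b : Bool} :
    (f u, b) ∈ (C.rename f).1 ↔ (u, b) ∈ C.1 := by
  rw [Clause.mem_rename]
  constructor
  · rintro ⟨⟨u', b'⟩, h, h'⟩
    simp only [Prod.mk.injEq, EmbeddingLike.apply_eq_iff_eq] at h'
    obtain ⟨rfl, rfl⟩ := h'
    exact h
  · exact fun h => ⟨_, h, rfl⟩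

theorem Clause.mem_unrename {f : U ↪ V} {D : Clause V} {a : Literal U} :
    a ∈ (D.unrename f).1 ↔ (f a.1, a.2) ∈ D.1 :=
  Finset.mem_preimage (f := fun a : Literal U => ((f a.1, a.2) : Literal V))
    (hf := (renameLiteral_injective f).injOn)

theorem xorEval_singleton (f : U ↪ V) {N : U → Finset V} (hN : ∀ u, N u = {f u}) (σ : V → Bool)
    (u : U) : xorEval N σ u = σ (f u) := by
  rw [xorEval, hN, Finset.filter_singleton]
  cases h : σ (f u) <;> simp

variable [DecidableEq U] [DecidableEq V] [Fintype V] {G : SimpleGraph (U ⊕ V)} {f : U ↪ V}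

theorem mem_xorClause_iff_of_matching (hG : ∀ u, nbhd G u = {f u}) {C : Clause U} {E : Clause V} :
    E ∈ xorClause G C ↔ E = C.rename f := by
  have hvars : C.vars.biUnion (nbhd G) = (C.rename f).vars := by
    ext v
    simp only [Finset.mem_biUnion, hG, Finset.mem_singleton, Clause.mem_vars, Clause.mem_rename]
    constructor
    · rintro ⟨u, ⟨b, h⟩, rfl⟩
      exact ⟨b, _, h, rfl⟩
    · rintro ⟨b, ⟨u, b'⟩, h, h'⟩
      exact ⟨u, ⟨b', h⟩, (congrArg Prod.fst h').symm⟩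
  have hfals : ∀ σ, C.FalsifiedBy (xorEval (nbhd G) σ) ↔ (C.rename f).FalsifiedBy σ := by
    intro σ
    constructor
    · intro h b hb
      obtain ⟨a, ha, rfl⟩ := Clause.mem_rename.1 hb
      have := h a ha
      rwa [xorEval_singleton f hG] at this
    · intro h a ha
      rw [xorEval_singleton f hG]
      exact h (f a.1, a.2) (Clause.mem_rename.2 ⟨a, ha, rfl⟩)
  rw [mem_xorClause_iff, hvars]
  constructor
  · rintro ⟨h1, h2⟩
    obtain ⟨σ, hσ⟩ := E.exists_falsifiedBy
    rw [hσ.eq_falsClause, h1, ← ((hfals σ).1 (h2 σ hσ)).eq_falsClause]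
  · rintro rfl
    exact ⟨rfl, fun σ => (hfals σ).2⟩

/-- XORification with respect to a matching is a renaming of variables, so that refutations can be
carried over in both directions. -/
theorem exists_refutation_xorify_of_matching (hG : ∀ u, nbhd G u = {f u}) {F : CNF U}
    (π : Refutation F) : ∃ π' : Refutation (xorify G F), π'.width ≤ π.width := by
  obtain ⟨π', h, -⟩ := exists_refutation_map (F' := xorify G F) (Clause.rename f) rfl
    (fun C hC => (mem_xorify_iff G).2 ⟨C, hC, (mem_xorClause_iff_of_matching hG).2 rfl⟩)
    (fun C D h => Finset.image_subset_image h) (fun C => Finset.card_image_le)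
    (fun x A A' D h => Or.inl ⟨f x, Clause.mk_mem_rename.2 h.1, Clause.mk_mem_rename.2 h.2.1, by
      have hinj := renameLiteral_injective f
      simp only [Clause.rename, h.2.2, Finset.image_union]
      rw [Finset.image_erase hinj, Finset.image_erase hinj]⟩) π
  exact ⟨π', h⟩

theorem exists_refutation_of_xorify_of_matching (hG : ∀ u, nbhd G u = {f u}) {F : CNF U}
    (π : Refutation (xorify G F)) :
    ∃ π' : Refutation F, π'.width ≤ π.width ∧ π'.space ≤ π.space := by
  refine exists_refutation_map (Clause.unrename f) ?_ ?_ ?_ ?_ ?_ π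
  · apply Subtype.ext
    ext a
    simp [Clause.mem_unrename, emptyClause]
  · intro D hD
    obtain ⟨C, hC, hD⟩ := (mem_xorify_iff G).1 hD
    rw [mem_xorClause_iff_of_matching hG] at hD
    convert hC
    apply Subtype.ext
    ext ⟨u, b⟩
    rw [Clause.mem_unrename, hD, Clause.mk_mem_rename]
  · intro C D h a ha
    rw [Clause.mem_unrename] at ha ⊢
    exact h ha
  · intro D
    refine Finset.card_le_card_of_injOn (fun a => (f a.1, a.2))
      (fun a ha => Clause.mem_unrename.1 ha) (renameLiteral_injective f).injOn
  · rintro x A A' D ⟨h₁, h₂, h₃⟩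
    by_cases hx : ∃ y, f y = x
    · obtain ⟨y, rfl⟩ := hx
      refine Or.inl ⟨y, Clause.mem_unrename.2 h₁, Clause.mem_unrename.2 h₂, ?_⟩
      ext ⟨u, b⟩
      simp only [Clause.mem_unrename, h₃, Finset.mem_union, Finset.mem_erase, ne_eq,
        Prod.mk.injEq, EmbeddingLike.apply_eq_iff_eq]
    · refine Or.inr fun a ha => ?_
      rw [Clause.mem_unrename] at ha ⊢
      rw [h₃, Finset.mem_union, Finset.mem_erase]
      exact Or.inl ⟨fun h => hx ⟨_, congrArg Prod.fst h⟩, ha⟩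

end Matching

/-! ### Bipartite graphs with given neighbourhoods -/

section Graph

variable {U V : Type*}

/-- The bipartite graph in which `u : U` has the neighbours `N u`. -/
def graphOfNbhd (N : U → Finset V) : SimpleGraph (U ⊕ V) :=
  SimpleGraph.fromRel fun a b => ∃ u v, a = Sum.inl u ∧ b = Sum.inr v ∧ v ∈ N u

theorem graphOfNbhd_isBipartiteWith (N : U → Finset V) :
    (graphOfNbhd N).IsBipartiteWith (Set.range Sum.inl) (Set.range Sum.inr) := by
  refine ⟨Set.isCompl_range_inl_range_inr.disjoint, ?_⟩
  rintro a b ⟨-, ⟨u, v, rfl, rfl, -⟩ | ⟨u, v, rfl, rfl, -⟩⟩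
  · exact Or.inl ⟨⟨u, rfl⟩, ⟨v, rfl⟩⟩
  · exact Or.inr ⟨⟨v, rfl⟩, ⟨u, rfl⟩⟩

theorem nbhd_graphOfNbhd [Fintype V] (N : U → Finset V) : nbhd (graphOfNbhd N) = N := by
  ext u v
  simp only [nbhd, Finset.mem_filter, Finset.mem_univ, true_and]
  simp [graphOfNbhd]

end Graph

/-! ### Existence of expanders -/

section Expander

/-- Every element of the union of the sets `N u` that is not in their symmetric difference lies in
at least two of them. -/
theorem two_mul_card_biUnion_le {U V : Type*} [Fintype V] [DecidableEq V] (N : U → Finset V)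
    (T : Finset U) :
    2 * (T.biUnion N).card ≤ (xorSum N T).card + ∑ u ∈ T, (N u).card := by
  have h1 : ∑ u ∈ T, (N u).card =
      ∑ v ∈ T.biUnion N, (T.filter fun u => v ∈ N u).card := by
    refine Eq.trans (Finset.sum_congr rfl fun u hu => ?_)
      (Finset.sum_card_bipartiteAbove_eq_sum_card_bipartiteBelow (fun u v => v ∈ N u))
    congr 1
    ext v
    simp only [Finset.bipartiteAbove, Finset.mem_filter, Finset.mem_biUnion]
    exact ⟨fun h => ⟨⟨u, hu, h⟩, h⟩, fun h => h.2⟩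
  have h2 : ((T.biUnion N).filter (· ∈ xorSum N T)).card ≤ (xorSum N T).card :=
    Finset.card_le_card fun v hv => (Finset.mem_filter.1 hv).2
  have h3 : 2 * (T.biUnion N).card ≤ ∑ v ∈ T.biUnion N,
      ((if v ∈ xorSum N T then 1 else 0) + (T.filter fun u => v ∈ N u).card) := by
    rw [mul_comm, ← smul_eq_mul, ← Finset.sum_const]
    refine Finset.sum_le_sum fun v hv => ?_
    obtain ⟨u, hu, hv⟩ := Finset.mem_biUnion.1 hv
    have h4 : 0 < (T.filter fun u => v ∈ N u).card :=
      Finset.card_pos.2 ⟨u, Finset.mem_filter.2 ⟨hu, hv⟩⟩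
    split_ifs with h
    · omega
    · rw [mem_xorSum, Nat.odd_iff] at h
      omega
  rw [Finset.sum_add_distrib, ← h1, ← Finset.card_filter] at h3
  omega

/-- The number of choices of `d` neighbours (with repetition) for each of `N` vertices such that
the vertices in `T` have all their neighbours in `W`. -/
theorem card_piFinset_ite {N d n : ℕ} (T : Finset (Fin N)) (W : Finset (Fin n)) (hn : 0 < n) :
    ((Fintype.piFinset fun p : Fin N × Fin d => if p.1 ∈ T then W else Finset.univ).card : ℝ) =
      (W.card / n : ℝ) ^ (d * T.card) * (n : ℝ) ^ (N * d) := by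
  have hn' : (n : ℝ) ≠ 0 := by positivity
  rw [Fintype.card_piFinset, Nat.cast_prod]
  have h1 : ∀ p : Fin N × Fin d,
      (((if p.1 ∈ T then W else Finset.univ : Finset (Fin n)).card : ℕ) : ℝ) =
        (if p.1 ∈ T then (W.card / n : ℝ) else 1) * n := by
    intro p
    split_ifs
    · field_simp
    · simp
  rw [Finset.prod_congr rfl fun p _ => h1 p, Finset.prod_mul_distrib]
  congr 1
  · rw [Fintype.prod_prod_type_right, Finset.prod_congr rfl fun i _ =>
      show _ = (W.card / n : ℝ) ^ T.card by simp [div_pow]]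
    rw [Finset.prod_const, Finset.card_univ, Fintype.card_fin, ← pow_mul, mul_comm]
  · simp

/-- For a random choice of `d` neighbours of each vertex, the expected number of pairs of a set
`T` of `t` vertices and a set `W` of `m` vertices that contains all neighbours of `T` is at most
`p ^ t`, where `p` is the base of the power on the right. -/
theorem choose_mul_choose_mul_pow_le {N d n r t m : ℕ} (hn : 0 < n) (ht : t ≤ r)
    (hm : 4 * m ≤ 3 * (d * t)) (hq : d * r ≤ n) (hr : 0 < r) (hd : 0 < d) :
    (N.choose t : ℝ) * (n.choose m) * (m / n : ℝ) ^ (d * t) ≤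
      (N * Real.exp d * (d * r / n : ℝ) ^ (d / 4 : ℝ)) ^ t := by
  have hn' : (0 : ℝ) < n := by positivity
  have hdr : m ≤ d * r := by
    have := Nat.mul_le_mul_left d ht
    omega
  have hmdt : m ≤ d * t := by omega
  set q : ℝ := d * r / n with hqdef
  have hq0 : 0 < q := by positivity
  have hq1 : q ≤ 1 := by
    rw [hqdef, div_le_one hn']
    exact_mod_cast hq
  have h1 : (N.choose t : ℝ) ≤ (N : ℝ) ^ t := by
    exact_mod_cast Nat.choose_le_pow N t
  have h2 : (n.choose m : ℝ) * (m / n : ℝ) ^ (d * t) ≤ Real.exp m * q ^ (d * t - m) := by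
    calc (n.choose m : ℝ) * (m / n : ℝ) ^ (d * t)
        ≤ ((n : ℝ) ^ m / (m.factorial : ℝ)) * (m / n : ℝ) ^ (d * t) := by
          gcongr
          exact Nat.choose_le_pow_div m n
      _ = ((m : ℝ) ^ m / (m.factorial : ℝ)) * (m / n : ℝ) ^ (d * t - m) := by
          conv_lhs => rw [← Nat.add_sub_cancel' hmdt]
          rw [pow_add, div_pow (m : ℝ) (n : ℝ) m]
          field_simp
      _ ≤ Real.exp m * q ^ (d * t - m) := by
          gcongr
          · exact Real.pow_div_factorial_le_exp (m : ℝ) (Nat.cast_nonneg m) m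
          · rw [hqdef]
            gcongr
            exact_mod_cast hdr
  have h3 : q ^ (d * t - m) ≤ (q ^ (d / 4 : ℝ)) ^ t := by
    rw [← Real.rpow_natCast, ← Real.rpow_natCast, ← Real.rpow_mul hq0.le]
    refine Real.rpow_le_rpow_of_exponent_ge hq0 hq1 ?_
    rw [Nat.cast_sub hmdt, Nat.cast_mul]
    have : (4 : ℝ) * m ≤ 3 * (d * t) := by exact_mod_cast hm
    linarith
  have h4 : Real.exp m ≤ Real.exp d ^ t := by
    rw [← Real.exp_nat_mul, Real.exp_le_exp, mul_comm]
    exact_mod_cast hmdt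
  calc (N.choose t : ℝ) * (n.choose m) * (m / n : ℝ) ^ (d * t)
      = (N.choose t : ℝ) * ((n.choose m) * (m / n : ℝ) ^ (d * t)) := by ring
    _ ≤ (N : ℝ) ^ t * (Real.exp d ^ t * (q ^ (d / 4 : ℝ)) ^ t) := by
        have := h2.trans (mul_le_mul h4 h3 (by positivity) (by positivity))
        exact mul_le_mul h1 this (by positivity) (by positivity)
    _ = _ := by rw [← mul_pow, ← mul_pow, mul_assoc]

/-- A random choice of `d` neighbours for each vertex leads to few coincidences of neighbours in
all small sets of vertices. -/
theorem exists_neighbours {N d n r : ℕ} (hn : 0 < n) (hr : 0 < r) (hd : 0 < d) (hq : d * r ≤ n)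
    (hp : N * Real.exp d * (d * r / n : ℝ) ^ (d / 4 : ℝ) ≤ 1 / 2) :
    ∃ g : Fin N × Fin d → Fin n, ∀ T : Finset (Fin N), T.card ≤ r →
      3 * (d * T.card) ≤ 4 * ((T ×ˢ Finset.univ).image g).card := by
  by_contra! hbad
  -- The neighbours of a violating set of size `t` lie in a set of size `m t`.
  let m : ℕ → ℕ := fun t => 3 * (d * t) / 4
  have hcover : (Finset.univ : Finset (Fin N × Fin d → Fin n)) ⊆
      (Finset.Icc 1 r).biUnion fun t => (Finset.powersetCard t Finset.univ).biUnion fun T =>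
        (Finset.powersetCard (m t) Finset.univ).biUnion fun W =>
          Fintype.piFinset fun p : Fin N × Fin d => if p.1 ∈ T then W else Finset.univ := by
    intro g _
    obtain ⟨T, hT, hlt⟩ := hbad g
    have hT0 : 1 ≤ T.card := by
      by_contra! h
      rw [Nat.lt_one_iff] at h
      simp [h] at hlt
    have hmn : m T.card ≤ Fintype.card (Fin n) := by
      rw [Fintype.card_fin]
      have := Nat.mul_le_mul_left d hT
      simp only [m]
      omega
    obtain ⟨W, hW, hWc⟩ := Finset.exists_superset_card_eq
      (s := (T ×ˢ (Finset.univ : Finset (Fin d))).image g) (n := m T.card)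
      (by simp only [m]; omega) hmn
    simp only [Finset.mem_biUnion, Finset.mem_Icc, Finset.mem_powersetCard_univ,
      Fintype.mem_piFinset]
    refine ⟨T.card, ⟨hT0, hT⟩, T, rfl, W, hWc, fun p => ?_⟩
    split_ifs with hp
    · exact hW (Finset.mem_image_of_mem g (Finset.mem_product.2 ⟨hp, Finset.mem_univ _⟩))
    · exact Finset.mem_univ _
  have h1 := Finset.card_le_card hcover
  rw [Finset.card_univ, Fintype.card_fun, Fintype.card_prod, Fintype.card_fin, Fintype.card_fin,
    Fintype.card_fin] at h1
  have h2 : ((n ^ (N * d) : ℕ) : ℝ) ≤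
      ∑ t ∈ Finset.Icc 1 r, (1 / 2 : ℝ) ^ t * (n : ℝ) ^ (N * d) := by
    refine (Nat.cast_le.2 (h1.trans Finset.card_biUnion_le)).trans ?_
    rw [Nat.cast_sum]
    refine Finset.sum_le_sum fun t ht => ?_
    have ht' := (Finset.mem_Icc.1 ht).2
    refine (Nat.cast_le.2 Finset.card_biUnion_le).trans ?_
    rw [Nat.cast_sum]
    have h3 : ∀ T ∈ Finset.powersetCard t (Finset.univ : Finset (Fin N)),
        ((((Finset.powersetCard (m t) Finset.univ).biUnion fun W : Finset (Fin n) =>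
          Fintype.piFinset fun p : Fin N × Fin d =>
            if p.1 ∈ T then W else Finset.univ).card : ℕ) : ℝ) ≤
        (n.choose (m t)) * ((m t / n : ℝ) ^ (d * t) * (n : ℝ) ^ (N * d)) := by
      intro T hT
      refine (Nat.cast_le.2 Finset.card_biUnion_le).trans ?_
      rw [Nat.cast_sum]
      rw [Finset.sum_congr rfl fun W hW => by
        rw [card_piFinset_ite T W hn, (Finset.mem_powersetCard.1 hT).2,
          (Finset.mem_powersetCard.1 hW).2]]
      rw [Finset.sum_const, Finset.card_powersetCard, Finset.card_univ, Fintype.card_fin,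
        nsmul_eq_mul]
    refine (Finset.sum_le_sum h3).trans ?_
    rw [Finset.sum_const, Finset.card_powersetCard, Finset.card_univ, Fintype.card_fin,
      nsmul_eq_mul, ← mul_assoc, ← mul_assoc]
    gcongr
    refine (choose_mul_choose_mul_pow_le hn ht' (by simp only [m]; omega) hq hr hd).trans ?_
    gcongr
  have h4 : ∑ t ∈ Finset.Icc 1 r, (1 / 2 : ℝ) ^ t < 1 := by
    have : ∀ r : ℕ, ∑ t ∈ Finset.Icc 1 r, (1 / 2 : ℝ) ^ t = 1 - (1 / 2) ^ r := by
      intro r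
      induction r with
      | zero => simp
      | succ r ih => rw [Finset.sum_Icc_succ_top (by omega), ih, pow_succ]; ring
    rw [this]
    have : (0 : ℝ) < (1 / 2) ^ r := by positivity
    linarith
  rw [← Finset.sum_mul, Nat.cast_pow] at h2
  have h5 : (0 : ℝ) < (n : ℝ) ^ (N * d) := by positivity
  nlinarith

/-- If the union of `t` neighbourhoods has at least `3 * d * t / 4` elements, then their symmetric
difference has at least `2 * (3 * d * t / 4) - d * t = d * t / 2` elements. -/
theorem exists_isXorExpander {N d n r : ℕ} (hn : 0 < n) (hr : 0 < r) (hd : 8 ≤ d) (hq : d * r ≤ n)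
    (hp : N * Real.exp d * (d * r / n : ℝ) ^ (d / 4 : ℝ) ≤ 1 / 2) :
    ∃ P : Fin N → Finset (Fin n), (∀ u, (P u).card ≤ d) ∧ IsXorExpander P r := by
  obtain ⟨g, hg⟩ := exists_neighbours hn hr (by omega) hq hp
  have hcard : ∀ u, (Finset.univ.image fun i => g (u, i)).card ≤ d := fun u =>
    Finset.card_image_le.trans (by simp)
  refine ⟨fun u => Finset.univ.image fun i => g (u, i), hcard, fun T hT => ?_⟩
  have h1 := two_mul_card_biUnion_le (fun u => Finset.univ.image fun i => g (u, i)) T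
  have h2 : (T.biUnion fun u => Finset.univ.image fun i => g (u, i)) =
      (T ×ˢ Finset.univ).image g := by
    ext v
    simp only [Finset.mem_biUnion, Finset.mem_image, Finset.mem_univ, true_and,
      Finset.mem_product, and_true, Prod.exists]
    exact ⟨fun ⟨u, hu, i, h⟩ => ⟨u, i, hu, h⟩, fun ⟨u, i, hu, h⟩ => ⟨u, hu, i, h⟩⟩
  have h3 : ∑ u ∈ T, (Finset.univ.image fun i => g (u, i)).card ≤ d * T.card := by
    rw [mul_comm, ← smul_eq_mul]
    exact Finset.sum_le_card_nsmul _ _ _ fun u _ => hcard u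
  have h4 := hg T hT
  have h5 := Nat.mul_le_mul_right T.card hd
  rw [h2] at h1
  omega

open Filter in
/-- The parameters of the expander: for large `n` the bound on the failure probability holds for
degree `d = ⌊ℓ / K⌋` and expansion up to sets of size `ℓ * log₂ n + 1`. -/
theorem eventually_exists_isXorExpander {ε : ℝ} (hε : 0 < ε) (K : ℕ) (hK : 1 ≤ K) :
    ∀ᶠ n : ℕ in atTop, ∀ ℓ N : ℕ, 8 * K ≤ ℓ → (ℓ : ℝ) ≤ (n : ℝ) ^ ((1 : ℝ) / 2 - ε) →
      (N : ℝ) ≤ (n : ℝ) ^ (ε / (32 * K) * ℓ) →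
      ∃ P : Fin N → Finset (Fin n), (∀ u, (P u).card ≤ ℓ / K) ∧
        IsXorExpander P (⌊(ℓ : ℝ) * Real.logb 2 n⌋₊ + 1) := by
  have hlog : ∀ᶠ n : ℕ in atTop, Real.logb 2 n + 1 ≤ (n : ℝ) ^ ε := by
    have h1 := ((isLittleO_log_rpow_atTop hε).bound
      (c := Real.log 2 / 2) (by positivity)).and
      ((tendsto_rpow_atTop hε).eventually_ge_atTop 2)
    filter_upwards [tendsto_natCast_atTop_atTop.eventually h1, eventually_ge_atTop 1] with n h hn
    obtain ⟨h, h'⟩ := h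
    have hn' : (1 : ℝ) ≤ n := by exact_mod_cast hn
    rw [Real.norm_of_nonneg (Real.log_nonneg hn'), Real.norm_of_nonneg (by positivity)] at h
    have h2 : Real.logb 2 n ≤ (n : ℝ) ^ ε / 2 := by
      rw [Real.logb, div_le_iff₀ (Real.log_pos one_lt_two)]
      linarith
    linarith
  have hexp : ∀ᶠ n : ℕ in atTop, Real.exp 1 ≤ (n : ℝ) ^ (ε / 16) :=
    tendsto_natCast_atTop_atTop.eventually
      ((tendsto_rpow_atTop (by positivity)).eventually_ge_atTop _)
  have hhalf : ∀ᶠ n : ℕ in atTop, (2 : ℝ) ≤ (n : ℝ) ^ ε :=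
    tendsto_natCast_atTop_atTop.eventually ((tendsto_rpow_atTop hε).eventually_ge_atTop _)
  filter_upwards [hlog, hexp, hhalf, eventually_ge_atTop 2] with n hlog hexp hhalf hn ℓ N hℓ hℓn hN
  have hn0 : (0 : ℝ) < n := by positivity
  have hn1 : (1 : ℝ) ≤ n := by exact_mod_cast (by omega : 1 ≤ n)
  have hK' : (1 : ℝ) ≤ K := by exact_mod_cast hK
  have hℓ1 : (1 : ℝ) ≤ ℓ := by exact_mod_cast (by omega : 1 ≤ ℓ)
  have hd : 8 ≤ ℓ / K := (Nat.le_div_iff_mul_le (by omega)).2 hℓ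
  set d := ℓ / K with hddef
  set r := ⌊(ℓ : ℝ) * Real.logb 2 n⌋₊ + 1 with hrdef
  have hdℓ : (d : ℝ) ≤ ℓ := by exact_mod_cast Nat.div_le_self ℓ K
  have hℓd : (ℓ : ℝ) ≤ 2 * K * d := by
    have h1 := Nat.div_add_mod ℓ K
    have h2 := Nat.mod_lt ℓ (show 0 < K by omega)
    rw [← hddef] at h1
    have h3 : ℓ ≤ 2 * K * d := by nlinarith
    exact_mod_cast h3
  have hd8 : (8 : ℝ) ≤ d := by exact_mod_cast hd
  have hlog0 : 0 ≤ Real.logb 2 n := Real.logb_nonneg one_lt_two hn1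
  have hr : (r : ℝ) ≤ ℓ * (Real.logb 2 n + 1) := by
    have := Nat.floor_le (mul_nonneg (by positivity : (0 : ℝ) ≤ ℓ) hlog0)
    rw [hrdef]
    push_cast
    linarith
  have hdr : (d * r : ℝ) ≤ (n : ℝ) ^ (1 - ε) := by
    calc (d * r : ℝ) ≤ ℓ * (ℓ * (Real.logb 2 n + 1)) := by gcongr
      _ ≤ (n : ℝ) ^ ((1 : ℝ) / 2 - ε) * ((n : ℝ) ^ ((1 : ℝ) / 2 - ε) * (n : ℝ) ^ ε) := by gcongr
      _ = (n : ℝ) ^ (1 - ε) := by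
        rw [← Real.rpow_add hn0, ← Real.rpow_add hn0]
        ring_nf
  have hq : (d * r / n : ℝ) ≤ (n : ℝ) ^ (-ε) := by
    rw [div_le_iff₀ hn0]
    refine hdr.trans_eq ?_
    nth_rewrite 3 [← Real.rpow_one (n : ℝ)]
    rw [← Real.rpow_add hn0]
    ring_nf
  refine exists_isXorExpander (by omega) (by omega) hd ?_ ?_
  · have : (d * r : ℝ) ≤ n := hdr.trans (by
      conv_rhs => rw [← Real.rpow_one (n : ℝ)]
      exact Real.rpow_le_rpow_of_exponent_le hn1 (by linarith))
    exact_mod_cast this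
  · -- In powers of `n`, the factors contribute `ε d / 16`, `ε d / 16` and `-ε d / 4`.
    have h1 : (N : ℝ) ≤ (n : ℝ) ^ (ε * d / 16) := by
      refine hN.trans (Real.rpow_le_rpow_of_exponent_le hn1 ?_)
      rw [div_mul_eq_mul_div, div_le_iff₀ (by positivity)]
      nlinarith
    have h2 : Real.exp d ≤ (n : ℝ) ^ (ε * d / 16) := by
      calc Real.exp d = Real.exp 1 ^ d := by rw [← Real.exp_nat_mul, mul_one]
        _ ≤ ((n : ℝ) ^ (ε / 16)) ^ d := by gcongr
        _ = (n : ℝ) ^ (ε * d / 16) := by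
          rw [← Real.rpow_natCast, ← Real.rpow_mul hn0.le]
          ring_nf
    have h3 : (d * r / n : ℝ) ^ (d / 4 : ℝ) ≤ (n : ℝ) ^ (-(ε * d / 4)) := by
      refine (Real.rpow_le_rpow (by positivity) hq (by positivity)).trans_eq ?_
      rw [← Real.rpow_mul hn0.le]
      ring_nf
    calc (N : ℝ) * Real.exp d * (d * r / n : ℝ) ^ (d / 4 : ℝ)
        ≤ (n : ℝ) ^ (ε * d / 16) * (n : ℝ) ^ (ε * d / 16) * (n : ℝ) ^ (-(ε * d / 4)) := by gcongr
      _ = (n : ℝ) ^ (-(ε * d / 8)) := by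
        rw [← Real.rpow_add hn0, ← Real.rpow_add hn0]
        ring_nf
      _ ≤ (n : ℝ) ^ (-ε) := Real.rpow_le_rpow_of_exponent_le hn1 (by nlinarith)
      _ ≤ 1 / 2 := by
        rw [Real.rpow_neg hn0.le, one_div]
        exact inv_anti₀ two_pos hhalf

end Expander

theorem exists_isMinSpaceInWidth {V : Type*} [DecidableEq V] {F : CNF V} {w b : ℕ}
    (h : ∃ π : Refutation F, π.width ≤ w ∧ π.space ≤ b) : ∃ s, IsMinSpaceInWidth F w s ∧ s ≤ b := by
  obtain ⟨π, hw, hb⟩ := h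
  have hmem : π.space ∈ {m : ℕ | ∃ π : Refutation F, π.width ≤ w ∧ π.space = m} := ⟨π, hw, rfl⟩
  exact ⟨_, ⟨Nat.sInf_mem ⟨_, hmem⟩, fun m hm => Nat.sInf_le hm⟩, (Nat.sInf_le hmem).trans hb⟩

end Resolution

theorem mainTheorem2 (k : ℕ) (hk : 1 ≤ k) (ε : ℝ) (hε : 0 < ε) :
    ∃ n₀ : ℕ, 1 ≤ n₀ ∧ ∃ δ : ℝ, 0 < δ ∧
      ∀ ℓ n : ℕ, n₀ ≤ n → k ≤ ℓ → (ℓ : ℝ) ≤ (n : ℝ) ^ ((1 : ℝ) / 2 - ε) →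
        ∀ N : ℕ, N = ⌊(n : ℝ) ^ (δ * (ℓ : ℝ))⌋₊ →
          ∀ F : Resolution.CNF (Fin N), F.Unsatisfiable → Resolution.IsRefutationWidth F k →
            ∃ G : SimpleGraph (Fin N ⊕ Fin n),
              G.IsBipartiteWith (Set.range Sum.inl) (Set.range Sum.inr) ∧
              (∃ π : Resolution.Refutation (Resolution.xorify G F), π.width ≤ ℓ) ∧
              ∀ w : ℕ, (w : ℝ) ≤ (ℓ : ℝ) * Real.logb 2 (n : ℝ) →
                ∀ π : Resolution.Refutation (Resolution.xorify G F), π.width ≤ w →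
                  ∃ s : ℕ, Resolution.IsMinSpaceInWidth F w s ∧
                    ((s : ℝ) - (w : ℝ) - 3) * (2 : ℝ) ^ (-(w : ℤ)) ≤ (π.space : ℝ) := by
  obtain ⟨n₁, hn₁⟩ := Filter.eventually_atTop.1
    (Resolution.eventually_exists_isXorExpander hε (k + 1) (by omega))
  have hK : (0 : ℝ) < ((k + 1 : ℕ) : ℝ) := by positivity
  refine ⟨max n₁ 1, le_max_right _ _, min (ε / (32 * (k + 1 : ℕ))) (1 / (8 * (k + 1 : ℕ))),
    lt_min (by positivity) (by positivity), ?_⟩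
  intro ℓ n hn hkℓ hℓn N hN F _ hF
  obtain ⟨π₀, hπ₀⟩ := hF.1
  have hn1 : (1 : ℝ) ≤ n := by exact_mod_cast (le_max_right n₁ 1).trans hn
  have hNle : ∀ x : ℝ, min (ε / (32 * (k + 1 : ℕ))) (1 / (8 * (k + 1 : ℕ))) ≤ x →
      (N : ℝ) ≤ (n : ℝ) ^ (x * ℓ) := by
    intro x hx
    rw [hN]
    refine (Nat.floor_le (by positivity)).trans (Real.rpow_le_rpow_of_exponent_le hn1 ?_)
    gcongr
  have hspace : ∀ (w s b : ℕ), s ≤ b * 2 ^ w + w + 3 →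
      ((s : ℝ) - (w : ℝ) - 3) * (2 : ℝ) ^ (-(w : ℤ)) ≤ (b : ℝ) := by
    intro w s b h
    rw [zpow_neg, zpow_natCast, ← div_eq_mul_inv, div_le_iff₀ (by positivity)]
    have : (s : ℝ) ≤ b * 2 ^ w + w + 3 := by exact_mod_cast h
    linarith
  rcases lt_or_ge ℓ (8 * (k + 1)) with hℓ | hℓ
  · -- There are at most `n` variables, so that a matching suffices.
    have hNn : N ≤ n := by
      have h1 := hNle _ (min_le_right _ _)
      have h2 : 1 / (8 * (k + 1 : ℕ)) * (ℓ : ℝ) ≤ 1 := by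
        rw [one_div_mul_eq_div, div_le_one (by positivity)]
        exact_mod_cast hℓ.le
      have h3 := h1.trans (Real.rpow_le_rpow_of_exponent_le hn1 h2)
      rw [Real.rpow_one] at h3
      exact_mod_cast h3
    have hG : ∀ u : Fin N, Resolution.nbhd
        (Resolution.graphOfNbhd fun u : Fin N => {Fin.castLEEmb hNn u}) u =
          {Fin.castLEEmb hNn u} := fun u => by
      rw [Resolution.nbhd_graphOfNbhd]
    refine ⟨_, Resolution.graphOfNbhd_isBipartiteWith fun u => {Fin.castLEEmb hNn u}, ?_, ?_⟩
    · obtain ⟨π, hπ⟩ := Resolution.exists_refutation_xorify_of_matching hG π₀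
      exact ⟨π, by omega⟩
    · intro w _ π hπ
      obtain ⟨π', hw, hs⟩ := Resolution.exists_refutation_of_xorify_of_matching hG π
      obtain ⟨s, hs, hsb⟩ := Resolution.exists_isMinSpaceInWidth ⟨π', hw.trans hπ, hs⟩
      refine ⟨s, hs, hspace w s _ ?_⟩
      have := Nat.le_mul_of_pos_right π.space (Nat.two_pow_pos w)
      omega
  · obtain ⟨P, hP, hexp⟩ := hn₁ n ((le_max_left _ _).trans hn) ℓ N hℓ hℓn
      (hNle _ (min_le_left _ _))
    rw [← Resolution.nbhd_graphOfNbhd P] at hexp hP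
    refine ⟨_, Resolution.graphOfNbhd_isBipartiteWith P, ?_, ?_⟩
    · obtain ⟨π, hπ⟩ := Resolution.exists_refutation_xorify hP π₀ hπ₀.le
      exact ⟨π, hπ.trans (Nat.div_mul_le_self _ _)⟩
    · intro w hw π hπ
      obtain ⟨s, hs, hsb⟩ := Resolution.exists_isMinSpaceInWidth
        (Resolution.exists_refutation_of_xorify hexp (Nat.succ_le_succ (Nat.le_floor hw)) π hπ)
      exact ⟨s, hs, hspace w s _ hsb⟩
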